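/- Let $N\ge 2$ and $\ell>0$, let $\Sigma=\mathbb T^{N-1}=(\mathbb R/\mathbb Z)^{N-1}$ and $\Omega=\Sigma\times(0,\ell)$, with points $z=(x,y)$, $x\in\Sigma$, $y\in(0,\ell)$. For $f$ on $\Sigma$ and $\xi\in\mathbb Z^{N-1}$ write $\hat f(\xi)=\int_\Sigma f(x)e^{-2\pi i\xi\cdot x}\,dx$ (for functions on $\Omega$ the transform is taken in $x$ only). Let $\mu:\mathbb Z^{N-1}\to\mathbb R$ satisfy $\theta\le\mu(\xi)\le\frac1\theta(1+|\xi|)^3$ for all $\xi$ and some $\theta>0$, and let $M$ be the Fourier multiplier $\widehat{M(h)}(\xi)=\mu(\xi)\hat h(\xi)$. Let $H$ be the space of $v\in H^1(\Omega;\mathbb R^N)$ with $\operatorname{div}v=0$ and $v=0$ on $\{y=0\}$, normed by $H^1$ and embedded in $H^*$ through the $L^2(\Omega)$ inner product, and let $(\mathbb Dv)_{ij}=\partial_iv_j+\partial_jv_i$. A weak solution with data $u_0\in L^2(\Omega;\mathbb R^N)$, $h_0\in L^2(\Sigma)$ is a pair $(u,h)$ of functions of $t\ge0$, $h$ real valued,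 such that $u\in L^2_{\rm loc}([0,\infty);H)$, $\partial_tu\in L^2_{\rm loc}([0,\infty);H^*)$, $h,M(h)\in L^2_{\rm loc}([0,\infty);L^2(\Sigma))$, $\partial_th\in L^2_{\rm loc}([0,\infty);H^{1/2}(\Sigma))$ (weak time derivatives), and * for every $T>0$ and every $v\in L^2([0,T];H)$, for a.e. $t\in[0,T]$: $\displaystyle[\partial_tu,v]_{H^*,H}+\tfrac12(\mathbb Du,\mathbb Dv)_{L^2(\Omega)}+\int_{\{y=\ell\}}M(h)\,v_N\,dx=0$; * $\partial_th=u_N$ on $\{y=\ell\}$ for a.e. $t$; * $u=u_0$ and $h=h_0$ at $t=0$, i.e. $u(t)\to u_0$ in $L^2(\Omega)$ and $h(t)\to h_0$ in $L^2(\Sigma)$ as $t\downarrow0$ outside a null set of times; * $\int_\Sigma h(x,t)\,dx=0$ for a.e. $t$. Set $\mathcal E_\xi(t)=\frac12\int_0^\ell|\hat u(\xi,y,t)|^2\,dy+\frac{\mu(\xi)}2|\hat h(\xi,t)|^2$, which is defined for a.e. $t$, and let $\mathcal E_\xi(0)$ be the same expression with $(u_0,h_0)$ in place of $(u(t),h(t))$.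 **Theorem.** There is a constant $\delta>0$, depending only on $N$ and $\ell$, such that for every such $\mu$ and every weak solution $(u,h)$ the function $\mathcal E_0$ agrees for a.e. $t>0$ with a continuous function on $[0,\infty)$ whose value at $t=0$ is $\mathcal E_0(0)$, and this continuous representative, again denoted $\mathcal E_0$, satisfies $$\mathcal E_0(t)\le\mathcal E_0(0)\,e^{-\delta t}\qquad\text{for all }t\ge0 .$$ -/

import Mathlib

open MeasureTheory Set Filter Topology
open scoped ENNReal ContDiff

noncomputable section

namespace SlabFlow

/-! ### The domain

`d = N - 1` is the number of horizontal variables.  The slab is `T^d × (0, ℓ)`; its points are pairs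
`(x, y)`.  Vectors of `ℝ^N` are indexed by `Fin (d + 1)`: the index `i.castSucc` is the `i`-th
horizontal direction and `Fin.last d` is the vertical direction. -/

/-- The horizontal cross section `T^d = (ℝ/ℤ)^d`. -/
abbrev Torus (d : ℕ) : Type := Fin d → UnitAddCircle

/-- Lebesgue measure on the slab `T^d × (0, ℓ)`, as a measure on `T^d × ℝ`. -/
def slabMeasure (d : ℕ) (ℓ : ℝ) : Measure (Torus d × ℝ) :=
  volume.restrict (univ ×ˢ Ioo (0 : ℝ) ℓ)

/-- Translation of a point of `T^d × ℝ` by `s` in the `j`-th coordinate direction. -/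
def shift {d : ℕ} (j : Fin (d + 1)) (s : ℝ) (z : Torus d × ℝ) : Torus d × ℝ :=
  Fin.lastCases (motive := fun _ => Torus d × ℝ) (z.1, z.2 + s)
    (fun i => (z.1 + Pi.single i (s : UnitAddCircle), z.2)) j

/-- The classical partial derivative `∂_j φ` on `T^d × ℝ`. -/
def partialDeriv {d : ℕ} (j : Fin (d + 1)) (φ : Torus d × ℝ → ℝ) (z : Torus d × ℝ) : ℝ :=
  deriv (fun s : ℝ => φ (shift j s z)) 0

/-- The quotient map `ℝ^d × ℝ → T^d × ℝ`. -/
def unroll {d : ℕ} (p : (Fin d → ℝ) × ℝ) : Torus d × ℝ :=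
  (fun i => (p.1 i : UnitAddCircle), p.2)

/-- `φ` is a `C^∞` function on `T^d × ℝ`, i.e. its periodic lift to `ℝ^d × ℝ` is `C^∞`. -/
def IsSmooth {d : ℕ} (φ : Torus d × ℝ → ℝ) : Prop :=
  ContDiff ℝ ∞ (fun p : (Fin d → ℝ) × ℝ => φ (unroll p))

/-- `φ ∈ C_c^∞(T^d × (0, ℓ))`. -/
def IsTestFunction {d : ℕ} (ℓ : ℝ) (φ : Torus d × ℝ → ℝ) : Prop :=
  IsSmooth φ ∧ HasCompactSupport φ ∧ tsupport φ ⊆ univ ×ˢ Ioo (0 : ℝ) ℓ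

/-! ### Weak derivatives and traces -/

/-- `g` is the weak `j`-th partial derivative of `f` in the slab. -/
def HasWeakPartial {d : ℕ} (ℓ : ℝ) (j : Fin (d + 1)) (f g : Torus d × ℝ → ℝ) : Prop :=
  ∀ φ : Torus d × ℝ → ℝ, IsTestFunction ℓ φ →
    ∫ z, f z * partialDeriv j φ z ∂(slabMeasure d ℓ) = - ∫ z, g z * φ z ∂(slabMeasure d ℓ)

/-- For `f ∈ H^1` with vertical weak derivative `fy = ∂_y f`: the trace of `f` on `{y = ℓ}` is `g`.
The trace is characterized by integration by parts against all functions that are smooth up to the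
boundary and vanish on `{y = 0}`. -/
def HasTopTrace {d : ℕ} (ℓ : ℝ) (f fy : Torus d × ℝ → ℝ) (g : Torus d → ℝ) : Prop :=
  ∀ φ : Torus d × ℝ → ℝ, IsSmooth φ → (∀ x, φ (x, 0) = 0) →
    ∫ z, (f z * partialDeriv (Fin.last d) φ z + fy z * φ z) ∂(slabMeasure d ℓ)
      = ∫ x, g x * φ (x, ℓ)

/-- For `f ∈ H^1` with vertical weak derivative `fy = ∂_y f`: the trace of `f` on `{y = 0}` is zero.
As for `HasTopTrace`, with functions that vanish on `{y = ℓ}`. -/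
def HasZeroBottomTrace {d : ℕ} (ℓ : ℝ) (f fy : Torus d × ℝ → ℝ) : Prop :=
  ∀ φ : Torus d × ℝ → ℝ, IsSmooth φ → (∀ x, φ (x, ℓ) = 0) →
    ∫ z, (f z * partialDeriv (Fin.last d) φ z + fy z * φ z) ∂(slabMeasure d ℓ) = 0

/-! ### The velocity space -/

/-- `L²(Ω; ℝ^N)`. -/
abbrev VecL2 (d : ℕ) (ℓ : ℝ) : Type :=
  Lp (EuclideanSpace ℝ (Fin (d + 1))) 2 (slabMeasure d ℓ)

/-- Pairs `(v, G)` with `v ∈ L²(Ω; ℝ^N)` and `G = (G_j)_j ∈ L²(Ω; ℝ^N)^N`; the Hilbert norm is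
`(‖v‖² + ∑_j ‖G_j‖²)^{1/2}`, which is the `H^1` norm when `G_j = ∂_j v`. -/
abbrev JetL2 (d : ℕ) (ℓ : ℝ) : Type :=
  WithLp 2 (VecL2 d ℓ × PiLp 2 (fun _ : Fin (d + 1) => VecL2 d ℓ))

section Smoothness

variable {d : ℕ} {ℓ : ℝ}

lemma isOpenQuotientMap_unroll : IsOpenQuotientMap (unroll (d := d)) := by
  have h1 : IsOpenQuotientMap (fun p : Fin d → ℝ => fun i => (p i : UnitAddCircle)) := by
    refine ⟨fun x => ?_, ?_, ?_⟩
    · choose p hp using fun i => QuotientAddGroup.mk_surjective (x i)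
      exact ⟨p, funext hp⟩
    · exact continuous_pi fun i => (AddCircle.continuous_mk' 1).comp (continuous_apply i)
    · exact IsOpenMap.piMap (fun _ => QuotientAddGroup.isOpenMap_coe)
        (Filter.Eventually.of_forall fun _ => QuotientAddGroup.mk_surjective)
  exact h1.prodMap IsOpenQuotientMap.id

lemma IsSmooth.continuous {φ : Torus d × ℝ → ℝ} (h : IsSmooth φ) : Continuous φ :=
  isOpenQuotientMap_unroll.continuous_comp_iff.1 (ContDiff.continuous h)

/-- The `j`-th coordinate vector of `ℝ^d × ℝ`. -/
def coordVec (j : Fin (d + 1)) : (Fin d → ℝ) × ℝ :=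
  Fin.lastCases (motive := fun _ => (Fin d → ℝ) × ℝ) (0, 1) (fun i => (Pi.single i 1, 0)) j

lemma shift_unroll (j : Fin (d + 1)) (s : ℝ) (p : (Fin d → ℝ) × ℝ) :
    shift j s (unroll p) = unroll (p + s • coordVec j) := by
  induction j using Fin.lastCases with
  | last => simp [shift, unroll, coordVec]
  | cast i =>
    simp only [shift, unroll, coordVec, Fin.lastCases_castSucc]
    ext k
    · by_cases hk : k = i
      · subst hk; simp
      · simp [hk]
    · simp

lemma partialDeriv_unroll {φ : Torus d × ℝ → ℝ} (h : IsSmooth φ) (j : Fin (d + 1))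
    (p : (Fin d → ℝ) × ℝ) :
    partialDeriv j φ (unroll p) = fderiv ℝ (fun q => φ (unroll q)) p (coordVec j) := by
  have hd : DifferentiableAt ℝ (fun q => φ (unroll q)) p :=
    (ContDiff.differentiable h (by simp)) p
  simp only [partialDeriv, shift_unroll]
  exact hd.lineDeriv_eq_fderiv

lemma IsSmooth.continuous_partialDeriv {φ : Torus d × ℝ → ℝ} (h : IsSmooth φ)
    (j : Fin (d + 1)) : Continuous (partialDeriv j φ) := by
  refine isOpenQuotientMap_unroll.continuous_comp_iff.1 ?_
  have : partialDeriv j φ ∘ unroll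
      = fun p => fderiv ℝ (fun q => φ (unroll q)) p (coordVec j) :=
    funext fun p => partialDeriv_unroll h j p
  rw [this]
  exact (ContDiff.continuous_fderiv h (by simp)).clm_apply continuous_const

instance : IsFiniteMeasure (slabMeasure d ℓ) := by
  refine ⟨?_⟩
  have hsub : (univ ×ˢ Ioo (0 : ℝ) ℓ : Set (Torus d × ℝ)) ⊆ univ ×ˢ Icc (0 : ℝ) ℓ :=
    prod_mono le_rfl Ioo_subset_Icc_self
  rw [slabMeasure, Measure.restrict_apply_univ]
  exact (measure_mono hsub).trans_lt (isCompact_univ.prod isCompact_Icc).measure_lt_top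

lemma integrable_mul_of_continuous {i : Fin (d + 1)} (v : VecL2 d ℓ) {ψ : Torus d × ℝ → ℝ}
    (hψ : Continuous ψ) : Integrable (fun z => v z i * ψ z) (slabMeasure d ℓ) := by
  have hv : Integrable (fun z => v z i) (slabMeasure d ℓ) := by
    have := (Lp.memLp v).integrable (by norm_num)
    exact this.eval_piLp i
  obtain ⟨C, hC⟩ := (isCompact_univ.prod (isCompact_Icc (a := (0 : ℝ)) (b := ℓ))).exists_bound_of_continuousOn
    (f := ψ) hψ.continuousOn
  refine hv.mul_bdd (c := C) hψ.aestronglyMeasurable ?_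
  refine (ae_restrict_iff' (measurableSet_prod.2 (Or.inl ⟨.univ, measurableSet_Ioo⟩))).2 ?_
  exact Eventually.of_forall fun z hz => hC z ⟨hz.1, Ioo_subset_Icc_self hz.2⟩

/-- Integration of the `i`-th component against a continuous function, as a linear map. -/
def testAgainst (i : Fin (d + 1)) {ψ : Torus d × ℝ → ℝ} (hψ : Continuous ψ) :
    VecL2 d ℓ →ₗ[ℝ] ℝ where
  toFun v := ∫ z, v z i * ψ z ∂(slabMeasure d ℓ)
  map_add' v w := by
    rw [← integral_add (integrable_mul_of_continuous v hψ) (integrable_mul_of_continuous w hψ)]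
    refine integral_congr_ae ?_
    filter_upwards [Lp.coeFn_add v w] with z hz
    rw [hz, Pi.add_apply, PiLp.add_apply, add_mul]
  map_smul' c v := by
    rw [RingHom.id_apply, smul_eq_mul, ← integral_const_mul]
    refine integral_congr_ae ?_
    filter_upwards [Lp.coeFn_smul c v] with z hz
    rw [hz, Pi.smul_apply, PiLp.smul_apply, smul_eq_mul, mul_assoc]

lemma hasWeakPartial_iff (i j : Fin (d + 1)) (v g : VecL2 d ℓ) :
    HasWeakPartial ℓ j (fun z => v z i) (fun z => g z i) ↔
      ∀ φ : Torus d × ℝ → ℝ, ∀ h : IsTestFunction ℓ φ,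
        testAgainst i (h.1.continuous_partialDeriv j) v = - testAgainst i h.1.continuous g :=
  Iff.rfl

lemma hasZeroBottomTrace_iff (i : Fin (d + 1)) (v g : VecL2 d ℓ) :
    HasZeroBottomTrace ℓ (fun z => v z i) (fun z => g z i) ↔
      ∀ φ : Torus d × ℝ → ℝ, ∀ h : IsSmooth φ, (∀ x, φ (x, ℓ) = 0) →
        testAgainst i (h.continuous_partialDeriv (Fin.last d)) v
          + testAgainst i h.continuous g = 0 := by
  refine forall_congr' fun φ => forall_congr' fun h => forall_congr' fun _ => ?_
  rw [integral_add (integrable_mul_of_continuous v (h.continuous_partialDeriv _))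
    (integrable_mul_of_continuous g h.continuous)]
  rfl

end Smoothness

/-- The space of divergence-free `H^1` vector fields on the slab that vanish on `{y = 0}`.
An element is the pair `(v, ∇v)`; `w.fst` is the field and `w.snd j` is its weak derivative
`∂_j v`. -/
def divFree (d : ℕ) (ℓ : ℝ) : Submodule ℝ (JetL2 d ℓ) where
  carrier := {w |
    (∀ i j, HasWeakPartial ℓ j (fun z => w.fst z i) (fun z => w.snd j z i)) ∧
    (∀ i, HasZeroBottomTrace ℓ (fun z => w.fst z i) (fun z => w.snd (Fin.last d) z i)) ∧
    ∀ᵐ z ∂(slabMeasure d ℓ), ∑ i, w.snd i z i = 0}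
  zero_mem' := by
    refine ⟨fun i j => ?_, fun i => ?_, ?_⟩
    · rw [hasWeakPartial_iff]
      intro φ h
      simp
    · rw [hasZeroBottomTrace_iff]
      intro φ h _
      simp
    · filter_upwards [Lp.coeFn_zero (EuclideanSpace ℝ (Fin (d + 1))) 2 (slabMeasure d ℓ)] with z hz
      refine Finset.sum_eq_zero fun i _ => ?_
      change ((0 : VecL2 d ℓ) z) i = 0
      rw [hz]
      rfl
  add_mem' := by
    rintro v w ⟨hv1, hv2, hv3⟩ ⟨hw1, hw2, hw3⟩
    refine ⟨fun i j => ?_, fun i => ?_, ?_⟩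
    · have h1 := (hasWeakPartial_iff _ _ _ _).1 (hv1 i j)
      have h2 := (hasWeakPartial_iff _ _ _ _).1 (hw1 i j)
      refine (hasWeakPartial_iff _ _ _ _).2 fun φ h => ?_
      simp only [WithLp.add_fst, WithLp.add_snd, PiLp.add_apply, map_add, h1 φ h, h2 φ h]
      ring
    · have h1 := (hasZeroBottomTrace_iff _ _ _).1 (hv2 i)
      have h2 := (hasZeroBottomTrace_iff _ _ _).1 (hw2 i)
      refine (hasZeroBottomTrace_iff _ _ _).2 fun φ h h0 => ?_
      simp only [WithLp.add_fst, WithLp.add_snd, PiLp.add_apply, map_add]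
      linarith [h1 φ h h0, h2 φ h h0]
    · have hc : ∀ᵐ z ∂(slabMeasure d ℓ), ∀ i, (v + w).snd i z = v.snd i z + w.snd i z :=
        ae_all_iff.2 fun i => Lp.coeFn_add (v.snd i) (w.snd i)
      filter_upwards [hv3, hw3, hc] with z h1 h2 h3
      simp_rw [h3, PiLp.add_apply, Finset.sum_add_distrib, h1, h2, add_zero]
  smul_mem' := by
    rintro c v ⟨hv1, hv2, hv3⟩
    refine ⟨fun i j => ?_, fun i => ?_, ?_⟩
    · have h1 := (hasWeakPartial_iff _ _ _ _).1 (hv1 i j)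
      refine (hasWeakPartial_iff _ _ _ _).2 fun φ h => ?_
      simp only [WithLp.smul_fst, WithLp.smul_snd, PiLp.smul_apply, map_smul, h1 φ h, smul_neg]
    · have h1 := (hasZeroBottomTrace_iff _ _ _).1 (hv2 i)
      refine (hasZeroBottomTrace_iff _ _ _).2 fun φ h h0 => ?_
      simp only [WithLp.smul_fst, WithLp.smul_snd, PiLp.smul_apply, map_smul, ← smul_add,
        h1 φ h h0, smul_zero]
    · have hc : ∀ᵐ z ∂(slabMeasure d ℓ), ∀ i, (c • v).snd i z = c • v.snd i z :=
        ae_all_iff.2 fun i => Lp.coeFn_smul c (v.snd i)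
      filter_upwards [hv3, hc] with z h1 h3
      simp_rw [h3, PiLp.smul_apply, smul_eq_mul, ← Finset.mul_sum, h1, mul_zero]

/-- The inclusion of the velocity space into `L²(Ω; ℝ^N)`. -/
def toL2 (d : ℕ) (ℓ : ℝ) : divFree d ℓ →L[ℝ] VecL2 d ℓ :=
  (WithLp.fstL 2 ℝ (VecL2 d ℓ) (PiLp 2 (fun _ : Fin (d + 1) => VecL2 d ℓ))).comp
    (divFree d ℓ).subtypeL

/-- The dual of the velocity space. -/
abbrev DivFreeDual (d : ℕ) (ℓ : ℝ) : Type := divFree d ℓ →L[ℝ] ℝ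

/-- An `L²` field `v` as the functional `w ↦ (v, w)_{L²}` on the velocity space. -/
def l2ToDual {d : ℕ} {ℓ : ℝ} (v : VecL2 d ℓ) : DivFreeDual d ℓ :=
  (innerSL ℝ v).comp (toL2 d ℓ)

/-- The symmetrized gradient `(𝔻v)_{ij} = ∂_i v_j + ∂_j v_i`. -/
def symGrad {d : ℕ} {ℓ : ℝ} (v : divFree d ℓ) (i j : Fin (d + 1)) (z : Torus d × ℝ) : ℝ :=
  v.1.snd i z j + v.1.snd j z i

/-- The `L²(Ω)` inner product `(𝔻v, 𝔻w)`. -/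
def symGradInner {d : ℕ} {ℓ : ℝ} (v w : divFree d ℓ) : ℝ :=
  ∫ z, ∑ i, ∑ j, symGrad v i j z * symGrad w i j z ∂(slabMeasure d ℓ)

/-- `g` is the vertical component `v_N` on `{y = ℓ}`. -/
def HasVerticalTopTrace {d : ℕ} {ℓ : ℝ} (v : divFree d ℓ) (g : Torus d → ℝ) : Prop :=
  HasTopTrace ℓ (fun z => v.1.fst z (Fin.last d)) (fun z => v.1.snd (Fin.last d) z (Fin.last d)) g

/-! ### Fourier coefficients on the torus -/

/-- `𝓕 f(ξ) = ∫_{T^d} f(x) e^{-2πi ξ·x} dx`. -/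
def fourierCoeffTorus {d : ℕ} (f : Torus d → ℂ) (ξ : Fin d → ℤ) : ℂ :=
  ∫ x, f x * UnitAddTorus.mFourier (-ξ) x

/-- The Euclidean length `|ξ|`. -/
def freqNorm {d : ℕ} (ξ : Fin d → ℤ) : ℝ := Real.sqrt (∑ i, (ξ i : ℝ) ^ 2)

/-- The square of the norm of `f` in `H^s(T^d)`, with value `∞` if `f` does not belong to it. -/
def sobolevNormSq {d : ℕ} (s : ℝ) (f : Torus d → ℂ) : ℝ≥0∞ :=
  ∑' ξ : Fin d → ℤ,
    ENNReal.ofReal ((1 + freqNorm ξ ^ 2) ^ s * ‖fourierCoeffTorus f ξ‖ ^ 2)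

/-- The admissible symbols: `θ ≤ μ(ξ) ≤ (1 + |ξ|)^3 / θ` for some `θ > 0`. -/
def IsAdmissibleSymbol {d : ℕ} (μ : (Fin d → ℤ) → ℝ) : Prop :=
  ∃ θ : ℝ, 0 < θ ∧ ∀ ξ, θ ≤ μ ξ ∧ μ ξ ≤ 1 / θ * (1 + freqNorm ξ) ^ 3

/-- `F = M(f)`, where `M` is the Fourier multiplier with symbol `μ`.  Since `μ` need not be even,
`F` may be complex valued. -/
def IsMultiplier {d : ℕ} (μ : (Fin d → ℤ) → ℝ) (f : Torus d → ℝ) (F : Torus d → ℂ) : Prop :=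
  ∀ ξ, fourierCoeffTorus F ξ = (μ ξ : ℂ) * fourierCoeffTorus (fun x => (f x : ℂ)) ξ

/-! ### Functions of time -/

/-- `f ∈ L²_loc([0, ∞); X)`. -/
def L2Loc {X : Type*} [NormedAddCommGroup X] (f : ℝ → X) : Prop :=
  ∀ T : ℝ, 0 < T → MemLp f 2 (volume.restrict (Icc 0 T))

/-- `f'` is the weak derivative of `f` on `(0, ∞)`, for functions with values in `X`. -/
def HasWeakTimeDeriv {X : Type*} [NormedAddCommGroup X] [NormedSpace ℝ X] (f f' : ℝ → X) : Prop :=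
  ∀ φ : ℝ → ℝ, ContDiff ℝ ∞ φ → HasCompactSupport φ → tsupport φ ⊆ Ioi 0 →
    ∫ t in Ioi (0 : ℝ), deriv φ t • f t = - ∫ t in Ioi (0 : ℝ), φ t • f' t

/-- `f = f₀` at `t = 0`: `f(t) → f₀` as `t ↓ 0` outside a null set of times.  If `f` has a
representative that is continuous on `[0, ∞)`, this says that `f₀` is its value at `t = 0`. -/
def HasInitialValue {X : Type*} [NormedAddCommGroup X] (f : ℝ → X) (f₀ : X) : Prop :=
  ∀ ε : ℝ, 0 < ε → ∃ τ : ℝ, 0 < τ ∧ ∀ᵐ t ∂(volume.restrict (Ioo 0 τ)), ‖f t - f₀‖ < ε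

/-! ### Weak solutions and the modal energy -/

/-- `(u, h)` is a weak solution with data `(u₀, h₀)`.  Here `ut`, `ht` and `Mh` stand for `∂_t u`,
`∂_t h` and `M(h)`, and the condition `div u = 0` is part of the velocity space. -/
def IsWeakSolution {d : ℕ} (ℓ : ℝ) (μ : (Fin d → ℤ) → ℝ)
    (u : ℝ → divFree d ℓ) (h : ℝ → Lp ℝ 2 (volume : Measure (Torus d)))
    (u₀ : VecL2 d ℓ) (h₀ : Lp ℝ 2 (volume : Measure (Torus d))) : Prop :=
  ∃ (ut : ℝ → DivFreeDual d ℓ) (ht : ℝ → Lp ℝ 2 (volume : Measure (Torus d)))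
    (Mh : ℝ → Lp ℂ 2 (volume : Measure (Torus d))),
    -- the regularity class
    L2Loc u ∧
    L2Loc ut ∧ HasWeakTimeDeriv (fun t => l2ToDual (toL2 d ℓ (u t))) ut ∧
    L2Loc h ∧
    L2Loc Mh ∧ (∀ᵐ t ∂(volume.restrict (Ioi (0 : ℝ))), IsMultiplier μ (h t) (Mh t)) ∧
    L2Loc ht ∧ HasWeakTimeDeriv h ht ∧
    (∀ T : ℝ, 0 < T →
      ∫⁻ t in Icc 0 T, sobolevNormSq (1 / 2) (fun x => (ht t x : ℂ)) < ⊤) ∧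
    -- `[∂_t u, v] + ½ (𝔻u, 𝔻v) + ∫_{y = ℓ} M(h) v_N = 0`
    (∀ T : ℝ, 0 < T → ∀ v : ℝ → divFree d ℓ, MemLp v 2 (volume.restrict (Icc 0 T)) →
      ∀ᵐ t ∂(volume.restrict (Icc 0 T)), ∀ g : Lp ℝ 2 (volume : Measure (Torus d)),
        HasVerticalTopTrace (v t) g →
          ((ut t (v t) + 1 / 2 * symGradInner (u t) (v t) : ℝ) : ℂ)
            + ∫ x, Mh t x * (g x : ℂ) = 0) ∧
    -- `∂_t h = u_N` on `{y = ℓ}`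
    (∀ᵐ t ∂(volume.restrict (Ioi (0 : ℝ))), HasVerticalTopTrace (u t) (ht t)) ∧
    -- the initial conditions
    HasInitialValue (fun t => toL2 d ℓ (u t)) u₀ ∧
    HasInitialValue h h₀ ∧
    -- the free surface has zero average
    (∀ᵐ t ∂(volume.restrict (Ioi (0 : ℝ))), ∫ x, h t x = 0)

/-- `𝓔_ξ = ½ ∫_0^ℓ |û(ξ, y)|² dy + (μ(ξ) / 2) |ĥ(ξ)|²`. -/
def modalEnergy {d : ℕ} (ℓ : ℝ) (μ : (Fin d → ℤ) → ℝ) (ξ : Fin d → ℤ)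
    (u : VecL2 d ℓ) (h : Lp ℝ 2 (volume : Measure (Torus d))) : ℝ :=
  1 / 2 * (∫ y in (0 : ℝ)..ℓ, ∑ i, ‖fourierCoeffTorus (fun x => (u (x, y) i : ℂ)) ξ‖ ^ 2)
    + μ ξ / 2 * ‖fourierCoeffTorus (fun x => (h x : ℂ)) ξ‖ ^ 2

end SlabFlow

end

noncomputable section

namespace SlabFlow

/-! At `ξ = 0` only horizontal averages enter the energy. The average of `h` is zero, so the surface
term drops out. The average of `u_N` is zero as well: by incompressibility its `y`-derivative is an
average of horizontal derivatives, hence zero, and `u_N` vanishes on `{y = 0}`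
(`sineCoeff_last_eq_zero`). What remains is the average of each horizontal component, which solves
the heat equation on `(0, ℓ)` with a Dirichlet condition at `y = 0` and the natural Neumann
condition at `y = ℓ`.

This problem is diagonalized by `sin (λ_k y)` with `λ_k = (k + 1/2) π / ℓ`. The shear field `sin
(λ_k y) e_i`, with `i` horizontal, is divergence free, vanishes at the bottom and has no vertical
component, so it is an admissible test field for which the term with `M(h)` disappears. Testing with
it gives the scalar equation `a' = -λ_k² a` for the corresponding coefficient `a`, in the weak sense
(`symGradInner_sineField`, `ae_eq_exp_of_weak_ode`); the initial condition fixes the constant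
(`IsWeakSolution.sineCoeff_ae_eq`).

By Parseval (`hasSum_sq_integral_sin`, `modalEnergy_zero_eq`) the zero-mode energy is `1 / ℓ` times
the sum of the squared coefficients, for almost every `t`. Inserting the exponentials yields a
series that is continuous on `[0, ∞)` and decays at least like `e^{-2 λ_0² t}`. -/

/-! ### Parseval's identity for the mixed Dirichlet–Neumann sine system -/

/-- The extension of `f` beyond `m` by `y ↦ s f(2m - y)`. -/
def reflectExt (s : ℂ) (m : ℝ) (f : ℝ → ℂ) (y : ℝ) : ℂ := if y ≤ m then f y else s * f (2 * m - y)

lemma memLp_reflectExt {m : ℝ} (s : ℂ) {f : ℝ → ℂ}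
    (hf : MemLp f 2 (volume.restrict (Ioo 0 m))) :
    MemLp (reflectExt s m f) 2 (volume.restrict (Ioo 0 (2 * m))) := by
  have hmp := (Measure.measurePreserving_sub_left (volume : Measure ℝ) (2 * m)).restrict_preimage
    (measurableSet_Ioo (a := 0) (b := m))
  have h2 : MemLp (fun y => s * f (2 * m - y)) 2 (volume.restrict (Ioo m (2 * m))) := by
    have := (hf.comp_measurePreserving hmp).const_mul s
    have hpre : (fun x => 2 * m - x) ⁻¹' Ioo 0 m = Ioo m (2 * m) := by
      ext x
      simp only [mem_preimage, mem_Ioo]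
      constructor <;> rintro ⟨h1, h2⟩ <;> constructor <;> linarith
    rwa [hpre] at this
  have hind := (memLp_indicator_iff_restrict (p := 2) (measurableSet_Ioo)).2 hf
  have hind2 := (memLp_indicator_iff_restrict (p := 2) (measurableSet_Ioo)).2 h2
  refine ((hind.add hind2).restrict (Ioo 0 (2 * m))).ae_eq ?_
  have hne : ∀ᵐ y : ℝ ∂(volume.restrict (Ioo 0 (2 * m))), y ≠ m :=
    ae_restrict_of_ae (Measure.ae_ne volume m)
  filter_upwards [hne, ae_restrict_mem measurableSet_Ioo] with y hy hy2
  rcases lt_or_gt_of_ne hy with h | h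
  · simp [reflectExt, indicator, h.le, hy2.1, h, not_lt.2 h.le]
  · simp [reflectExt, indicator, not_le.2 h, hy2.2, h, not_lt.2 h.le]

lemma intervalIntegral_fold {m : ℝ} (hm : 0 < m) {E : Type*} [NormedAddCommGroup E]
    [NormedSpace ℝ E] {G : ℝ → E}
    (hG : IntegrableOn G (Ioo 0 (2 * m))) :
    ∫ x in (0 : ℝ)..(2 * m), G x = ∫ x in (0 : ℝ)..m, (G x + G (2 * m - x)) := by
  have h0 : IntervalIntegrable G volume 0 (2 * m) :=
    (intervalIntegrable_iff_integrableOn_Ioo_of_le (by linarith)).2 hG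
  have h1 : IntervalIntegrable G volume 0 m :=
    h0.mono_set (by rw [uIcc_of_le, uIcc_of_le] <;> first | linarith | exact Icc_subset_Icc_right (by linarith))
  have h2 : IntervalIntegrable G volume m (2 * m) :=
    h0.mono_set (by rw [uIcc_of_le, uIcc_of_le] <;> first | linarith | exact Icc_subset_Icc_left (by linarith))
  have h3 : IntervalIntegrable (fun x => G (2 * m - x)) volume 0 m := by
    have := (h2.comp_sub_left (2 * m)).symm
    simpa [two_mul] using this
  rw [intervalIntegral.integral_add h1 h3, intervalIntegral.integral_comp_sub_left,
    ← intervalIntegral.integral_add_adjacent_intervals h1 h2]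
  simp [two_mul]

/-- Moves the reflection from `f` onto the continuous kernel, so that iterated reflections can be
undone one at a time. -/
lemma integral_mul_reflectExt {m : ℝ} (hm : 0 < m) (s : ℂ) {f : ℝ → ℂ}
    (hf : MemLp f 2 (volume.restrict (Ioo 0 m))) {K : ℝ → ℂ} (hK : Continuous K) :
    ∫ x in (0 : ℝ)..(2 * m), K x * reflectExt s m f x
      = ∫ x in (0 : ℝ)..m, (K x + s * K (2 * m - x)) * f x := by
  have hi : IntegrableOn (fun x => K x * reflectExt s m f x) (Ioo 0 (2 * m)) := by
    have h1 : IntegrableOn (reflectExt s m f) (Ioo 0 (2 * m)) :=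
      (memLp_reflectExt s hf).integrable (by norm_num)
    obtain ⟨C, hC⟩ := (isCompact_Icc (a := (0 : ℝ)) (b := 2 * m)).exists_bound_of_continuousOn
      (f := K) hK.continuousOn
    refine h1.bdd_mul (c := C) hK.aestronglyMeasurable ?_
    filter_upwards [ae_restrict_mem measurableSet_Ioo] with x hx
    exact hC x (Ioo_subset_Icc_self hx)
  rw [intervalIntegral_fold hm hi, intervalIntegral.integral_of_le hm.le,
    intervalIntegral.integral_of_le hm.le, integral_Ioc_eq_integral_Ioo,
    integral_Ioc_eq_integral_Ioo]
  refine setIntegral_congr_fun measurableSet_Ioo fun x hx => ?_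
  have h2 : ¬ (2 * m - x ≤ m) := by have := hx.2; linarith
  simp only [reflectExt, hx.2.le, h2, if_true, if_false, sub_sub_cancel]
  ring

lemma integral_norm_sq_reflectExt {m : ℝ} (hm : 0 < m) {s : ℂ} (hs : ‖s‖ = 1) {f : ℝ → ℂ}
    (hf : MemLp f 2 (volume.restrict (Ioo 0 m))) :
    ∫ x in (0 : ℝ)..(2 * m), ‖reflectExt s m f x‖ ^ 2 = 2 * ∫ x in (0 : ℝ)..m, ‖f x‖ ^ 2 := by
  have hi : IntegrableOn (fun x => ‖reflectExt s m f x‖ ^ 2) (Ioo 0 (2 * m)) :=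
    (memLp_two_iff_integrable_sq_norm (memLp_reflectExt s hf).1).1 (memLp_reflectExt s hf)
  rw [intervalIntegral_fold hm hi, ← intervalIntegral.integral_const_mul,
    intervalIntegral.integral_of_le hm.le,
    intervalIntegral.integral_of_le hm.le, integral_Ioc_eq_integral_Ioo,
    integral_Ioc_eq_integral_Ioo]
  refine setIntegral_congr_fun measurableSet_Ioo fun x hx => ?_
  have h2 : ¬ (2 * m - x ≤ m) := by have := hx.2; linarith
  simp only [reflectExt, hx.2.le, h2, if_true, if_false, sub_sub_cancel, norm_mul, hs]
  ring

/-- The frequencies `(k + 1/2) π / ℓ`. -/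
def sineFreq (ℓ : ℝ) (k : ℕ) : ℝ := (2 * k + 1) * Real.pi / (2 * ℓ)

/-- Even reflection about `ℓ` (Neumann) followed by odd reflection about `2ℓ` (Dirichlet) produces a
function of period `4ℓ`. Undoing the odd reflection turns the exponential into a sine; undoing the
even one leaves the factor `1 - (-1)^n`, which kills the even frequencies. -/
lemma fourierCoeffOn_reflectExt {ℓ : ℝ} (hℓ : 0 < ℓ) {f : ℝ → ℂ}
    (hf : MemLp f 2 (volume.restrict (Ioo 0 ℓ))) (hab : (0 : ℝ) < 2 * (2 * ℓ)) (n : ℤ) :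
    fourierCoeffOn hab (reflectExt (-1) (2 * ℓ) (reflectExt 1 ℓ f)) n
      = -(Complex.I / (2 * ℓ)) * (1 - (-1) ^ n)
        * ∫ y in (0 : ℝ)..ℓ, (Real.sin (n * Real.pi * y / (2 * ℓ)) : ℂ) * f y := by
  have hℓ' : (ℓ : ℂ) ≠ 0 := by exact_mod_cast hℓ.ne'
  rw [fourierCoeffOn_eq_integral]
  have hc : Continuous fun x : ℝ =>
      (fourier (-n) (x : AddCircle (2 * (2 * ℓ) - 0)) : ℂ) :=
    (map_continuous _).comp (AddCircle.continuous_mk' _)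
  simp only [smul_eq_mul]
  rw [integral_mul_reflectExt (by linarith) (-1) (memLp_reflectExt 1 hf) hc]
  have hK : ∀ x : ℝ, (fourier (-n) (x : AddCircle (2 * (2 * ℓ) - 0)) : ℂ)
      + -1 * (fourier (-n) ((2 * (2 * ℓ) - x : ℝ) : AddCircle (2 * (2 * ℓ) - 0)) : ℂ)
      = -2 * Complex.I * (Real.sin (n * Real.pi * x / (2 * ℓ)) : ℂ) := by
    intro x
    rw [fourier_coe_apply, fourier_coe_apply]
    have e1 : 2 * (Real.pi : ℂ) * Complex.I * ((-n : ℤ) : ℂ) * (x : ℂ)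
        / ((2 * (2 * ℓ) - 0 : ℝ) : ℂ)
        = -((n * Real.pi * x / (2 * ℓ) : ℝ) : ℂ) * Complex.I := by
      push_cast
      rw [sub_zero]
      field_simp
    have e2 : 2 * (Real.pi : ℂ) * Complex.I * ((-n : ℤ) : ℂ) * ((2 * (2 * ℓ) - x : ℝ) : ℂ)
        / ((2 * (2 * ℓ) - 0 : ℝ) : ℂ)
        = ((n * Real.pi * x / (2 * ℓ) : ℝ) : ℂ) * Complex.I
          + ((-n : ℤ) : ℂ) * (2 * Real.pi * Complex.I) := by
      push_cast
      rw [sub_zero]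
      field_simp
      ring
    rw [e1, e2, Complex.exp_add, Complex.exp_int_mul_two_pi_mul_I, mul_one, Complex.ofReal_sin,
      Complex.sin]
    linear_combination (Complex.exp (-((n * Real.pi * x / (2 * ℓ) : ℝ) : ℂ) * Complex.I)
      - Complex.exp (((n * Real.pi * x / (2 * ℓ) : ℝ) : ℂ) * Complex.I)) * Complex.I_sq
  simp only [hK]
  rw [integral_mul_reflectExt hℓ 1 hf (by fun_prop)]
  have hK2 : ∀ x : ℝ, -2 * Complex.I * (Real.sin (n * Real.pi * x / (2 * ℓ)) : ℂ)
      + 1 * (-2 * Complex.I * (Real.sin (n * Real.pi * (2 * ℓ - x) / (2 * ℓ)) : ℂ))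
      = -2 * Complex.I * (1 - (-1) ^ n) * (Real.sin (n * Real.pi * x / (2 * ℓ)) : ℂ) := by
    intro x
    have : n * Real.pi * (2 * ℓ - x) / (2 * ℓ)
        = n * Real.pi - n * Real.pi * x / (2 * ℓ) := by field_simp
    rw [this, Real.sin_int_mul_pi_sub]
    push_cast
    ring
  have hI : ∀ c : ℂ, ∫ x in (0 : ℝ)..ℓ, c * (Real.sin (n * Real.pi * x / (2 * ℓ)) : ℂ) * f x
      = c * ∫ x in (0 : ℝ)..ℓ, (Real.sin (n * Real.pi * x / (2 * ℓ)) : ℂ) * f x := fun c => by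
    simp only [mul_assoc, ← intervalIntegral.integral_const_mul]
  simp only [hK2]
  rw [hI, Complex.real_smul]
  push_cast
  rw [sub_zero]
  field_simp

/-- Parseval's identity for the system `sin ((k + 1/2) π y / ℓ)` on `(0, ℓ)`. -/
theorem hasSum_sq_integral_sin {ℓ : ℝ} (hℓ : 0 < ℓ) {f : ℝ → ℝ}
    (hf : MemLp f 2 (volume.restrict (Ioo 0 ℓ))) :
    HasSum (fun k : ℕ => (∫ y in (0 : ℝ)..ℓ, f y * Real.sin (sineFreq ℓ k * y)) ^ 2)
      (ℓ / 2 * ∫ y in (0 : ℝ)..ℓ, f y ^ 2) := by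
  have hab : (0 : ℝ) < 2 * (2 * ℓ) := by linarith
  have hf' : MemLp (fun y => (f y : ℂ)) 2 (volume.restrict (Ioo 0 ℓ)) := hf.ofReal
  set F := reflectExt (-1) (2 * ℓ) (reflectExt 1 ℓ fun y => (f y : ℂ)) with hF
  have hmem : MemLp F 2 (volume.restrict (Ioc 0 (2 * (2 * ℓ)))) := by
    rw [← Measure.restrict_congr_set Ioo_ae_eq_Ioc]
    exact memLp_reflectExt _ (memLp_reflectExt _ hf')
  have hP := hasSum_sq_fourierCoeffOn hab hmem
  rw [integral_norm_sq_reflectExt (by linarith) (by simp) (memLp_reflectExt _ hf'),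
    integral_norm_sq_reflectExt hℓ (by simp) hf'] at hP
  have hodd : HasSum (fun k : ℤ => ‖fourierCoeffOn hab F (2 * k + 1)‖ ^ 2)
      ((2 * (2 * ℓ) - 0)⁻¹ • (2 * (2 * ∫ y in (0 : ℝ)..ℓ, ‖(f y : ℂ)‖ ^ 2))) := by
    have hinj : Function.Injective fun k : ℤ => 2 * k + 1 := fun a b h => by
      simp only at h
      omega
    refine (hinj.hasSum_iff (f := fun n => ‖fourierCoeffOn hab F n‖ ^ 2) ?_).2 hP
    intro n hn
    have he : Even n := by
      rw [← Int.not_odd_iff_even]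
      rintro ⟨k, hk⟩
      exact hn ⟨k, hk.symm⟩
    rw [hF, fourierCoeffOn_reflectExt hℓ hf' hab, he.neg_one_zpow]
    simp
  have hval : ∀ k : ℤ, ‖fourierCoeffOn hab F (2 * k + 1)‖ ^ 2
      = ℓ⁻¹ ^ 2 * (∫ y in (0 : ℝ)..ℓ, f y * Real.sin ((2 * k + 1) * Real.pi / (2 * ℓ) * y)) ^ 2 := by
    intro k
    have hi : ∫ y in (0 : ℝ)..ℓ, (Real.sin (((2 * k + 1 : ℤ) : ℝ) * Real.pi * y / (2 * ℓ)) : ℂ)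
          * (f y : ℂ)
        = ((∫ y in (0 : ℝ)..ℓ, f y * Real.sin ((2 * k + 1) * Real.pi / (2 * ℓ) * y) : ℝ) : ℂ) := by
      rw [← intervalIntegral.integral_ofReal]
      refine intervalIntegral.integral_congr fun y _ => ?_
      rw [mul_comm, Complex.ofReal_mul]
      congr 3
      push_cast
      ring
    have ho : Odd (2 * k + 1) := ⟨k, rfl⟩
    rw [hF, fourierCoeffOn_reflectExt hℓ hf' hab, hi, ho.neg_one_zpow, norm_mul, mul_pow,
      Complex.norm_real, Real.norm_eq_abs, sq_abs]
    congr 1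
    rw [norm_mul, norm_neg, norm_div, Complex.norm_I, norm_mul, Complex.norm_real,
      Real.norm_of_nonneg hℓ.le]
    norm_num
    field_simp
  -- Index `k` is paired with `-(k + 1)`, i.e. frequency `2k + 1` with its negative. Each of the two
  -- equal terms is `ℓ⁻²` times the squared sine integral, whence the factor `ℓ² / 2` below.
  have hnat := hodd.nat_add_neg_add_one
  have h2 := hnat.mul_left (ℓ ^ 2 / 2)
  have hterm : ∀ k : ℕ, (∫ y in (0 : ℝ)..ℓ, f y * Real.sin (sineFreq ℓ k * y)) ^ 2
      = ℓ ^ 2 / 2 * (‖fourierCoeffOn hab F (2 * (k : ℤ) + 1)‖ ^ 2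
        + ‖fourierCoeffOn hab F (2 * (-((k : ℤ) + 1)) + 1)‖ ^ 2) := by
    intro k
    have hneg : ∫ y in (0 : ℝ)..ℓ, f y
          * Real.sin ((2 * ((-((k : ℤ) + 1) : ℤ) : ℝ) + 1) * Real.pi / (2 * ℓ) * y)
        = -∫ y in (0 : ℝ)..ℓ, f y * Real.sin ((2 * k + 1) * Real.pi / (2 * ℓ) * y) := by
      rw [← intervalIntegral.integral_neg]
      refine intervalIntegral.integral_congr fun y _ => ?_
      rw [← mul_neg, ← Real.sin_neg]
      congr 2
      push_cast
      ring
    rw [hval, hval, hneg, neg_sq]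
    simp only [sineFreq, Int.cast_natCast]
    field_simp
    ring
  have htot : ℓ / 2 * ∫ y in (0 : ℝ)..ℓ, f y ^ 2
      = ℓ ^ 2 / 2 * (2 * (2 * ℓ) - 0)⁻¹ • (2 * (2 * ∫ y in (0 : ℝ)..ℓ, ‖(f y : ℂ)‖ ^ 2)) := by
    simp only [Complex.norm_real, Real.norm_eq_abs, sq_abs, sub_zero, smul_eq_mul]
    field_simp
  rw [htot, funext hterm]
  exact h2

/-! ### Weak scalar differential equations on the half line -/

lemma integrableOn_Ioi_smul {E : Type*} [NormedAddCommGroup E] [NormedSpace ℝ E] {b : ℝ → E}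
    {φ : ℝ → ℝ} (hb : LocallyIntegrableOn b (Ioi 0))
    (hφ : Continuous φ) (hc : HasCompactSupport φ) (hs : tsupport φ ⊆ Ioi 0) :
    IntegrableOn (fun t => φ t • b t) (Ioi 0) := by
  have h1 : IntegrableOn b (tsupport φ) := hb.integrableOn_compact_subset hs hc
  obtain ⟨C, hC⟩ := hφ.bounded_above_of_compact_support hc
  have h2 : IntegrableOn (fun t => φ t • b t) (tsupport φ) :=
    h1.bdd_smul C hφ.aestronglyMeasurable (Eventually.of_forall hC)
  refine h2.of_forall_sdiff_eq_zero measurableSet_Ioi fun t ht => ?_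
  rw [image_eq_zero_of_notMem_tsupport ht.2, zero_smul]

/-- The antiderivative vanishes to the left of the support of `k`, and to the right of it because
the total integral is zero. Its base point `p / 2` lies strictly between `0` and the support. -/
lemma exists_antideriv_of_integral_eq_zero {k : ℝ → ℝ} (hk : ContDiff ℝ ∞ k)
    (hc : HasCompactSupport k) (hs : tsupport k ⊆ Ioi 0) (h0 : ∫ t, k t = 0) :
    ∃ ψ : ℝ → ℝ, ContDiff ℝ ∞ ψ ∧ HasCompactSupport ψ ∧ tsupport ψ ⊆ Ioi 0 ∧ deriv ψ = k := by
  obtain ⟨p, hp, hpk⟩ := IsCompact.exists_forall_le' hc (f := fun t : ℝ => t) continuousOn_id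
    (a := 0) hs
  obtain ⟨q, hq⟩ := IsCompact.bddAbove hc
  have hkp : ∀ t < p, k t = 0 := fun t ht =>
    image_eq_zero_of_notMem_tsupport fun h => absurd (hpk t h) (not_le.2 ht)
  have hkq : ∀ t > q, k t = 0 := fun t ht =>
    image_eq_zero_of_notMem_tsupport fun h => absurd (hq h) (not_le.2 ht)
  have hd : ∀ t, HasDerivAt (fun t => ∫ s in (p / 2)..t, k s) (k t) t := fun t =>
    intervalIntegral.integral_hasDerivAt_right (hk.continuous.intervalIntegrable _ _)
      (hk.continuous.stronglyMeasurableAtFilter _ _) hk.continuous.continuousAt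
  have hd' : deriv (fun t => ∫ s in (p / 2)..t, k s) = k := funext fun t => (hd t).deriv
  have hsupp : Function.support (fun t => ∫ s in (p / 2)..t, k s) ⊆ Icc (p / 2) (q + 1) := by
    intro t ht
    by_contra hn
    refine ht ?_
    rcases lt_or_ge t (p / 2) with h | h
    · refine intervalIntegral.integral_zero_ae (Eventually.of_forall fun s hs' => hkp s ?_)
      rw [uIoc_of_ge h.le] at hs'
      linarith [hs'.2]
    · have hqt : q + 1 < t := by
        by_contra h2
        exact hn ⟨h, not_lt.1 h2⟩
      simp only
      rw [intervalIntegral.integral_of_le h, ← h0]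
      refine setIntegral_eq_integral_of_forall_compl_eq_zero fun s hs' => ?_
      by_cases h3 : s ≤ p / 2
      · exact hkp s (by linarith)
      · refine hkq s ?_
        by_contra h4
        exact hs' ⟨not_le.1 h3, by linarith [not_lt.1 h4]⟩
  refine ⟨fun t => ∫ s in (p / 2)..t, k s, ?_, ?_, ?_, hd'⟩
  · rw [contDiff_infty_iff_deriv]
    exact ⟨fun t => (hd t).differentiableAt, by rwa [hd']⟩
  · exact HasCompactSupport.of_support_subset_isCompact isCompact_Icc hsupp
  · refine (closure_minimal hsupp isClosed_Icc).trans fun t ht => ?_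
    exact lt_of_lt_of_le (by linarith) ht.1

/-- Du Bois-Reymond's argument: for a bump `η` of mass one, `χ - (∫ χ) η` has mean zero and is thus
the derivative of a test function, so `∫ χ (b - c) = 0` with `c = ∫ η b`. -/
lemma ae_eq_const_of_weakDeriv_eq_zero {b : ℝ → ℝ} (hb : LocallyIntegrableOn b (Ioi 0))
    (h : ∀ φ : ℝ → ℝ, ContDiff ℝ ∞ φ → HasCompactSupport φ → tsupport φ ⊆ Ioi 0 →
      ∫ t in Ioi (0 : ℝ), deriv φ t * b t = 0) :
    ∃ c : ℝ, ∀ᵐ t ∂(volume.restrict (Ioi (0 : ℝ))), b t = c := by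
  -- Centre `2` and outer radius `1` keep the support in `[1, 3]`, away from `0`.
  let B : ContDiffBump (2 : ℝ) := ⟨1 / 2, 1, by norm_num, by norm_num⟩
  set η : ℝ → ℝ := B.normed volume with hη
  have hηd : ContDiff ℝ ∞ η := B.contDiff_normed
  have hηc : HasCompactSupport η := B.hasCompactSupport_normed
  have hηs : tsupport η ⊆ Ioi 0 := by
    rw [hη, B.tsupport_normed_eq]
    intro t ht
    rw [Real.closedBall_eq_Icc] at ht
    have : (2 : ℝ) - 1 ≤ t := ht.1
    exact lt_of_lt_of_le (by norm_num) this
  have hη1 : ∫ t, η t = 1 := B.integral_normed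
  refine ⟨∫ t in Ioi (0 : ℝ), η t * b t, ?_⟩
  set c := ∫ t in Ioi (0 : ℝ), η t * b t with hcdef
  rw [ae_restrict_iff' measurableSet_Ioi]
  have hbc : LocallyIntegrableOn (fun t => b t - c) (Ioi 0) :=
    hb.sub (locallyIntegrableOn_const c)
  have key := isOpen_Ioi.ae_eq_zero_of_integral_contDiff_smul_eq_zero hbc fun χ hχ hχc hχs => ?_
  · filter_upwards [key] with t ht hpos
    linarith [ht hpos]
  set k : ℝ → ℝ := fun t => χ t - (∫ s, χ s) * η t with hk
  have hkd : ContDiff ℝ ∞ k := hχ.sub (contDiff_const.mul hηd)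
  have hts : tsupport k ⊆ tsupport χ ∪ tsupport η := by
    refine closure_minimal (fun t ht => ?_) ((isClosed_tsupport _).union (isClosed_tsupport _))
    by_contra hn
    rw [mem_union, not_or] at hn
    refine ht ?_
    simp [hk, image_eq_zero_of_notMem_tsupport hn.1, image_eq_zero_of_notMem_tsupport hn.2]
  have hkc : HasCompactSupport k :=
    (IsCompact.union hχc hηc).of_isClosed_subset (isClosed_tsupport _) hts
  have hk0 : ∫ t, k t = 0 := by
    rw [hk, integral_sub (hχ.continuous.integrable_of_hasCompactSupport hχc)
      ((hηd.continuous.integrable_of_hasCompactSupport hηc).const_mul _), integral_const_mul, hη1]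
    ring
  obtain ⟨ψ, hψ, hψc, hψs, hψd⟩ := exists_antideriv_of_integral_eq_zero hkd hkc
    (hts.trans (union_subset hχs hηs)) hk0
  have h1 := h ψ hψ hψc hψs
  rw [hψd] at h1
  have i1 := integrableOn_Ioi_smul hb hχ.continuous hχc hχs
  have i2 := integrableOn_Ioi_smul hb hηd.continuous hηc hηs
  simp only [smul_eq_mul] at i1 i2
  have h2 : ∫ t in Ioi (0 : ℝ), k t * b t
      = (∫ t in Ioi (0 : ℝ), χ t * b t) - (∫ s, χ s) * c := by
    rw [hcdef, ← integral_const_mul, ← integral_sub i1 (i2.const_mul _)]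
    refine integral_congr_ae (Eventually.of_forall fun t => ?_)
    simp only [hk]
    ring
  have hset : ∀ F : ℝ → ℝ, ∫ t in Ioi (0 : ℝ), χ t * F t = ∫ t, χ t * F t := fun F => by
    refine setIntegral_eq_integral_of_forall_compl_eq_zero fun t ht => ?_
    rw [image_eq_zero_of_notMem_tsupport fun h' => ht (hχs h'), zero_mul]
  have i3 : IntegrableOn (fun t => χ t * c) (Ioi 0) :=
    ((hχ.continuous.integrable_of_hasCompactSupport hχc).mul_const c).integrableOn
  simp only [smul_eq_mul]
  rw [← hset]
  simp only [mul_sub]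
  rw [integral_sub i1 i3, hset fun _ => c, integral_mul_const]
  linarith

/-- A weak solution of `a' = -lam a` on `(0, ∞)` is a multiple of `e^{-lam t}`. -/
lemma ae_eq_exp_of_weak_ode {a : ℝ → ℝ} {lam : ℝ} (ha : LocallyIntegrableOn a (Ioi 0))
    (h : ∀ φ : ℝ → ℝ, ContDiff ℝ ∞ φ → HasCompactSupport φ → tsupport φ ⊆ Ioi 0 →
      ∫ t in Ioi (0 : ℝ), deriv φ t * a t = lam * ∫ t in Ioi (0 : ℝ), φ t * a t) :
    ∃ c : ℝ, ∀ᵐ t ∂(volume.restrict (Ioi (0 : ℝ))), a t = c * Real.exp (-lam * t) := by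
  -- Integrating factor: the test function `φ e^{lam t}` shows that `e^{lam t} a` has weak
  -- derivative zero.
  have hexp : ContDiff ℝ ∞ fun t : ℝ => Real.exp (lam * t) := by fun_prop
  have hb : LocallyIntegrableOn (fun t => Real.exp (lam * t) * a t) (Ioi 0) :=
    ha.continuousOn_mul hexp.continuous.continuousOn isOpen_Ioi.isLocallyClosed
  obtain ⟨c, hc⟩ := ae_eq_const_of_weakDeriv_eq_zero hb fun φ hφ hφc hφs => by
    have hd : ∀ t, deriv (fun t => φ t * Real.exp (lam * t)) t
        = deriv φ t * Real.exp (lam * t) + lam * (φ t * Real.exp (lam * t)) := fun t => by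
      have h1 : HasDerivAt φ (deriv φ t) t := ((hφ.differentiable (by simp)) t).hasDerivAt
      have h2 : HasDerivAt (fun t : ℝ => Real.exp (lam * t)) (Real.exp (lam * t) * lam) t := by
        simpa using ((hasDerivAt_id t).const_mul lam).exp
      exact (h1.mul h2).deriv.trans (by ring)
    have hs2 : tsupport (fun t => φ t * Real.exp (lam * t)) ⊆ tsupport φ := tsupport_mul_subset_left
    have h3 := h (fun t => φ t * Real.exp (lam * t)) (hφ.mul hexp) hφc.mul_right (hs2.trans hφs)
    have hφd : Continuous (deriv φ) := hφ.continuous_deriv (by simp)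
    have i1 := integrableOn_Ioi_smul hb hφd hφc.deriv
      ((tsupport_deriv_subset).trans hφs)
    have i2 := integrableOn_Ioi_smul hb hφ.continuous hφc hφs
    simp only [smul_eq_mul] at i1 i2
    have h4 : ∫ t in Ioi (0 : ℝ), deriv (fun t => φ t * Real.exp (lam * t)) t * a t
        = (∫ t in Ioi (0 : ℝ), deriv φ t * (Real.exp (lam * t) * a t))
          + lam * ∫ t in Ioi (0 : ℝ), φ t * (Real.exp (lam * t) * a t) := by
      rw [← integral_const_mul, ← integral_add i1 (i2.const_mul _)]
      refine integral_congr_ae (Eventually.of_forall fun t => ?_)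
      simp only [hd]
      ring
    rw [h4] at h3
    simp only [mul_assoc] at h3
    linarith
  refine ⟨c, ?_⟩
  filter_upwards [hc] with t ht
  rw [← ht, mul_right_comm, ← Real.exp_add]
  simp

/-- If `f` tends to `f₀` at `0` outside a null set and agrees almost everywhere with `g`, then `f₀`
is the limit of `g` at `0`. -/
lemma eq_of_ae_eq_of_tendsto {X : Type*} [NormedAddCommGroup X] {f : ℝ → X} {g : ℝ → X}
    {f₀ g₀ : X} (hf : ∀ ε : ℝ, 0 < ε → ∃ τ : ℝ, 0 < τ ∧
      ∀ᵐ t ∂(volume.restrict (Ioo 0 τ)), ‖f t - f₀‖ < ε)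
    (hfg : ∀ᵐ t ∂(volume.restrict (Ioi (0 : ℝ))), f t = g t)
    (hg : Tendsto g (𝓝[>] 0) (𝓝 g₀)) : f₀ = g₀ := by
  by_contra hne
  have hpos : 0 < ‖f₀ - g₀‖ := norm_pos_iff.2 (sub_ne_zero.2 hne)
  obtain ⟨τ, hτ, hfτ⟩ := hf (‖f₀ - g₀‖ / 2) (by linarith)
  have hg2 : ∀ᶠ t in 𝓝[>] (0 : ℝ), ‖g t - g₀‖ < ‖f₀ - g₀‖ / 2 := by
    have := Metric.tendsto_nhds.1 hg (‖f₀ - g₀‖ / 2) (by linarith)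
    simpa [dist_eq_norm] using this
  obtain ⟨σ, hσ, hgσ⟩ := mem_nhdsGT_iff_exists_Ioo_subset.1 hg2
  have hσ' : (0 : ℝ) < σ := hσ
  set ρ := min τ σ
  have hρ : 0 < ρ := lt_min hτ hσ'
  have h1 : ∀ᵐ t ∂(volume.restrict (Ioo 0 ρ)), ‖f t - f₀‖ < ‖f₀ - g₀‖ / 2 :=
    ae_restrict_of_ae_restrict_of_subset (Ioo_subset_Ioo_right (min_le_left _ _)) hfτ
  have h2 : ∀ᵐ t ∂(volume.restrict (Ioo 0 ρ)), f t = g t :=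
    ae_restrict_of_ae_restrict_of_subset (fun t ht => ht.1) hfg
  have h3 : ∀ᵐ t ∂(volume.restrict (Ioo 0 ρ)), t ∈ Ioo 0 ρ := ae_restrict_mem measurableSet_Ioo
  have hne0 : (ae (volume.restrict (Ioo 0 ρ))).NeBot := by
    rw [ae_neBot, ne_eq, Measure.restrict_eq_zero, Real.volume_Ioo, sub_zero]
    simpa using hρ
  -- `(0, ρ)` has positive measure, so the almost-everywhere statements hold together at some point
  -- of it.
  obtain ⟨t, ⟨ht1, ht2⟩, ht3⟩ := ((h1.and h2).and h3).exists
  have ht4 : ‖g t - g₀‖ < ‖f₀ - g₀‖ / 2 := hgσ ⟨ht3.1, ht3.2.trans_le (min_le_right _ _)⟩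
  rw [ht2] at ht1
  have := norm_sub_le (g t - g₀) (g t - f₀)
  rw [sub_sub_sub_cancel_left] at this
  linarith

variable {d : ℕ} {ℓ : ℝ}

/-! ### Horizontal averages -/

instance isProbabilityMeasure_torus : IsProbabilityMeasure (volume : Measure (Torus d)) := by
  refine ⟨?_⟩
  rw [← pi_univ (univ : Set (Fin d)), volume_pi_pi]
  simp

lemma slabMeasure_eq_prod :
    slabMeasure d ℓ = (volume : Measure (Torus d)).prod (volume.restrict (Ioo (0 : ℝ) ℓ)) := by
  rw [slabMeasure, Measure.volume_eq_prod, ← Measure.prod_restrict, Measure.restrict_univ]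

lemma integrable_slab_of_continuous {ψ : Torus d × ℝ → ℝ} (hψ : Continuous ψ) :
    Integrable ψ (slabMeasure d ℓ) := by
  have h : IntegrableOn ψ (univ ×ˢ Icc (0 : ℝ) ℓ) :=
    hψ.continuousOn.integrableOn_compact (isCompact_univ.prod isCompact_Icc)
  exact h.mono_set (prod_mono le_rfl Ioo_subset_Icc_self)

lemma ae_slab_mem : ∀ᵐ z ∂(slabMeasure d ℓ), z.2 ∈ Ioo (0 : ℝ) ℓ := by
  have := ae_restrict_mem (μ := (volume : Measure (Torus d × ℝ)))
    (MeasurableSet.univ.prod (measurableSet_Ioo (a := (0 : ℝ)) (b := ℓ)))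
  exact this.mono fun z hz => hz.2

lemma memLp_component (v : VecL2 d ℓ) (i : Fin (d + 1)) :
    MemLp (fun z => v z i) 2 (slabMeasure d ℓ) :=
  (Lp.memLp v).eval_piLp i

/-- The horizontal average `y ↦ ∫ f(x, y) dx`. -/
def horizontalAvg (f : Torus d × ℝ → ℝ) (y : ℝ) : ℝ := ∫ x, f (x, y)

lemma memLp_horizontalAvg {f : Torus d × ℝ → ℝ} (hf : MemLp f 2 (slabMeasure d ℓ)) :
    MemLp (horizontalAvg f) 2 (volume.restrict (Ioo 0 ℓ)) := by
  have h1 : Integrable f (slabMeasure d ℓ) := hf.integrable (by norm_num)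
  have h2 : Integrable (fun z => f z ^ 2) (slabMeasure d ℓ) := hf.integrable_sq
  rw [slabMeasure_eq_prod] at h1 h2
  have hm : AEStronglyMeasurable (horizontalAvg f) (volume.restrict (Ioo 0 ℓ)) :=
    h1.integral_prod_right.aestronglyMeasurable
  rw [memLp_two_iff_integrable_sq hm]
  refine h2.integral_prod_right.mono' (hm.pow 2) ?_
  filter_upwards [h1.prod_left_ae, h2.prod_left_ae] with y hy1 hy2
  have hy : MemLp (fun x => f (x, y)) 2 (volume : Measure (Torus d)) :=
    (memLp_two_iff_integrable_sq hy1.aestronglyMeasurable).2 hy2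
  -- Nonnegativity of the variance on the slice is `(∫ f)² ≤ ∫ f²`, the torus having mass one.
  have hv := ProbabilityTheory.variance_nonneg (fun x => f (x, y)) (volume : Measure (Torus d))
  rw [ProbabilityTheory.variance_eq_sub hy] at hv
  rw [Real.norm_of_nonneg (sq_nonneg _)]
  simpa [horizontalAvg] using hv

lemma integral_mul_vertical {f : Torus d × ℝ → ℝ} {ψ : ℝ → ℝ}
    (h : Integrable (fun z => f z * ψ z.2) (slabMeasure d ℓ)) :
    ∫ z, f z * ψ z.2 ∂(slabMeasure d ℓ) = ∫ y in Ioo (0 : ℝ) ℓ, horizontalAvg f y * ψ y := by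
  rw [slabMeasure_eq_prod] at h ⊢
  rw [integral_prod_symm _ h]
  refine integral_congr_ae (Eventually.of_forall fun y => ?_)
  simp only [horizontalAvg]
  rw [integral_mul_const]

lemma integral_component_mul (v : VecL2 d ℓ) (i : Fin (d + 1)) {ψ : ℝ → ℝ} (hψ : Continuous ψ) :
    ∫ z, v z i * ψ z.2 ∂(slabMeasure d ℓ)
      = ∫ y in Ioo (0 : ℝ) ℓ, horizontalAvg (fun z => v z i) y * ψ y :=
  integral_mul_vertical (integrable_mul_of_continuous (i := i) v (hψ.comp continuous_snd))

/-! ### Functions of the vertical variable -/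

lemma isSmooth_vertical {χ : ℝ → ℝ} (hχ : ContDiff ℝ ∞ χ) :
    IsSmooth (fun z : Torus d × ℝ => χ z.2) :=
  hχ.comp contDiff_snd

lemma partialDeriv_vertical_castSucc (χ : ℝ → ℝ) (i : Fin d) (z : Torus d × ℝ) :
    partialDeriv i.castSucc (fun z : Torus d × ℝ => χ z.2) z = 0 := by
  simp [partialDeriv, shift]

lemma partialDeriv_vertical_last (χ : ℝ → ℝ) (z : Torus d × ℝ) :
    partialDeriv (Fin.last d) (fun z : Torus d × ℝ => χ z.2) z = deriv χ z.2 := by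
  simp only [partialDeriv, shift, Fin.lastCases_last]
  rw [deriv_comp_const_add, add_zero]

lemma isTestFunction_vertical {χ : ℝ → ℝ} (hχ : ContDiff ℝ ∞ χ) (hc : HasCompactSupport χ)
    (hs : tsupport χ ⊆ Ioo 0 ℓ) : IsTestFunction ℓ (fun z : Torus d × ℝ => χ z.2) := by
  have hsub : tsupport (fun z : Torus d × ℝ => χ z.2) ⊆ univ ×ˢ tsupport χ := by
    refine closure_minimal (fun z hz => ⟨mem_univ _, subset_tsupport χ hz⟩)
      (isClosed_univ.prod (isClosed_tsupport χ))
  exact ⟨isSmooth_vertical hχ,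
    (isCompact_univ.prod hc).of_isClosed_subset (isClosed_tsupport _) hsub,
    hsub.trans (prod_mono le_rfl hs)⟩

/-- The horizontal average of a horizontal weak derivative vanishes. -/
lemma integral_horizontal_weakPartial_mul {v g : VecL2 d ℓ} {i : Fin (d + 1)} {j : Fin d}
    (h : HasWeakPartial ℓ j.castSucc (fun z => v z i) (fun z => g z i)) {ψ : ℝ → ℝ}
    (hψ : Continuous ψ) : ∫ z, g z i * ψ z.2 ∂(slabMeasure d ℓ) = 0 := by
  have hi : IntegrableOn (horizontalAvg fun z => g z i) (Ioo 0 ℓ) :=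
    (memLp_horizontalAvg (memLp_component g i)).integrable (by norm_num)
  -- Test functions of `y` alone have no horizontal derivative, so the average is zero almost
  -- everywhere. This then allows a `ψ` that does not vanish near the boundary.
  have key := isOpen_Ioo.ae_eq_zero_of_integral_contDiff_smul_eq_zero hi.locallyIntegrableOn
    fun χ hχ hχc hχs => by
      have h1 := h _ (isTestFunction_vertical hχ hχc hχs)
      simp only [partialDeriv_vertical_castSucc, mul_zero, integral_zero] at h1
      rw [integral_component_mul g i hχ.continuous] at h1
      rw [← setIntegral_eq_integral_of_forall_compl_eq_zero (s := Ioo 0 ℓ) fun t ht => by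
        rw [image_eq_zero_of_notMem_tsupport fun h' => ht (hχs h'), zero_smul]]
      simp only [smul_eq_mul, mul_comm (χ _)]
      linarith
  rw [integral_component_mul g i hψ]
  refine integral_eq_zero_of_ae ?_
  filter_upwards [ae_restrict_of_ae key, ae_restrict_mem measurableSet_Ioo] with y hy hy2
  simp [hy hy2]

/-! ### Integration by parts for smooth functions -/

lemma IsSmooth.hasDerivAt_shift {φ : Torus d × ℝ → ℝ} (h : IsSmooth φ) (j : Fin (d + 1))
    (z : Torus d × ℝ) (s : ℝ) :
    HasDerivAt (fun s => φ (shift j s z)) (partialDeriv j φ (shift j s z)) s := by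
  obtain ⟨p, rfl⟩ := isOpenQuotientMap_unroll.surjective z
  simp only [shift_unroll]
  rw [partialDeriv_unroll h]
  have h1 := ((ContDiff.differentiable h (by simp)) (p + s • coordVec j)).hasFDerivAt
  have h2 : HasDerivAt (fun s : ℝ => p + s • coordVec j) (coordVec j) s := by
    simpa using ((hasDerivAt_id s).smul_const (coordVec j)).const_add p
  exact h1.comp_hasDerivAt s h2

/-- By translation invariance the integral of `φ (x + s e_j, y)` does not depend on `s`; its
derivative at `s = 0` is the integral in question. -/
lemma integral_partialDeriv_castSucc {φ : Torus d × ℝ → ℝ} (h : IsSmooth φ) (j : Fin d) (y : ℝ) :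
    ∫ x, partialDeriv j.castSucc φ (x, y) = 0 := by
  have hsh : ∀ (s : ℝ) (x : Torus d), shift j.castSucc s (x, y)
      = (x + Pi.single j (s : UnitAddCircle), y) := fun s x => by simp [shift]
  have hcφ := h.continuous
  have hcd := h.continuous_partialDeriv j.castSucc
  obtain ⟨C, hC⟩ := (isCompact_univ.prod (isCompact_singleton (x := y))).exists_bound_of_continuousOn
    (f := partialDeriv j.castSucc φ) hcd.continuousOn
  have hint : ∀ {ψ : Torus d → ℝ}, Continuous ψ → Integrable ψ := fun hψ =>
    hψ.integrable_of_hasCompactSupport (HasCompactSupport.of_compactSpace _)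
  have hcont : ∀ s : ℝ, Continuous fun x : Torus d => φ (x + Pi.single j (s : UnitAddCircle), y) :=
    fun s => hcφ.comp (by fun_prop)
  have hder := hasDerivAt_integral_of_dominated_loc_of_deriv_le (μ := (volume : Measure (Torus d)))
    (F := fun (s : ℝ) x => φ (x + Pi.single j (s : UnitAddCircle), y))
    (F' := fun (s : ℝ) x => partialDeriv j.castSucc φ (x + Pi.single j (s : UnitAddCircle), y))
    (x₀ := 0) (s := univ) (bound := fun _ => C) univ_mem
    (Eventually.of_forall fun s => (hcont s).aestronglyMeasurable) (hint (hcont 0))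
    (hcd.comp (by fun_prop)).aestronglyMeasurable
    (Eventually.of_forall fun x s _ => hC _ ⟨mem_univ _, rfl⟩) (integrable_const C)
    (Eventually.of_forall fun x s _ => by
      have := h.hasDerivAt_shift j.castSucc (x, y) s
      simpa only [hsh] using this)
  have hconst : (fun s : ℝ => ∫ x : Torus d, φ (x + Pi.single j (s : UnitAddCircle), y))
      = fun _ => ∫ x : Torus d, φ (x, y) := funext fun s =>
    integral_add_right_eq_self (fun x : Torus d => φ (x, y)) _
  rw [hconst] at hder
  have := hder.2.unique (hasDerivAt_const _ _)
  simpa using this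

lemma integral_mul_partialDeriv_castSucc {φ : Torus d × ℝ → ℝ} (h : IsSmooth φ) (j : Fin d)
    {w : ℝ → ℝ} (hw : Continuous w) :
    ∫ z, w z.2 * partialDeriv j.castSucc φ z ∂(slabMeasure d ℓ) = 0 := by
  have hi : Integrable (fun z => w z.2 * partialDeriv j.castSucc φ z) (slabMeasure d ℓ) :=
    integrable_slab_of_continuous ((hw.comp continuous_snd).mul (h.continuous_partialDeriv _))
  rw [slabMeasure_eq_prod] at hi ⊢
  rw [integral_prod_symm _ hi]
  simp only [integral_const_mul, integral_partialDeriv_castSucc h, mul_zero, integral_zero]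

/-- Only the product `w φ` is required to vanish at the two ends. This covers both compactly
supported `φ` and the bottom-trace condition, where `w` vanishes at `0` and `φ` at `ℓ`. -/
lemma integral_mul_partialDeriv_last {φ : Torus d × ℝ → ℝ} (h : IsSmooth φ) (hℓ : 0 ≤ ℓ)
    {w w' : ℝ → ℝ} (hw : ∀ y, HasDerivAt w (w' y) y) (hw' : Continuous w')
    (h0 : ∀ x, w 0 * φ (x, 0) = 0) (h1 : ∀ x, w ℓ * φ (x, ℓ) = 0) :
    ∫ z, (w z.2 * partialDeriv (Fin.last d) φ z + w' z.2 * φ z) ∂(slabMeasure d ℓ) = 0 := by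
  have hwc : Continuous w := continuous_iff_continuousAt.2 fun y => (hw y).continuousAt
  have hd := h.continuous_partialDeriv (Fin.last d)
  have hφ := h.continuous
  have hcont : Continuous fun z : Torus d × ℝ =>
      w z.2 * partialDeriv (Fin.last d) φ z + w' z.2 * φ z := by fun_prop
  have hi := integrable_slab_of_continuous (ℓ := ℓ) hcont
  rw [slabMeasure_eq_prod] at hi ⊢
  rw [integral_prod _ hi]
  refine integral_eq_zero_of_ae (Eventually.of_forall fun x => ?_)
  have hder : ∀ y : ℝ, HasDerivAt (fun y => w y * φ (x, y))
      (w y * partialDeriv (Fin.last d) φ (x, y) + w' y * φ (x, y)) y := fun y => by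
    have h2 := h.hasDerivAt_shift (Fin.last d) (x, 0) y
    simp only [shift, Fin.lastCases_last, zero_add] at h2
    exact ((hw y).mul h2).congr_deriv (by ring)
  simp only [Pi.zero_apply]
  rw [← integral_Ioc_eq_integral_Ioo, ← intervalIntegral.integral_of_le hℓ,
    intervalIntegral.integral_eq_sub_of_hasDerivAt (fun y _ => hder y)
      ((hcont.comp (by fun_prop : Continuous fun y : ℝ => (x, y))).intervalIntegrable _ _),
    h0, h1, sub_zero]

/-! ### Sine coefficients -/

lemma memLp_vertical {w : ℝ → ℝ} (hw : Continuous w) (i : Fin (d + 1)) :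
    MemLp (fun z : Torus d × ℝ => EuclideanSpace.single i (w z.2)) 2 (slabMeasure d ℓ) := by
  obtain ⟨C, hC⟩ := (isCompact_Icc (a := (0 : ℝ)) (b := ℓ)).exists_bound_of_continuousOn
    (f := w) hw.continuousOn
  have hc : Continuous fun z : Torus d × ℝ => EuclideanSpace.single i (w z.2) := by
    have h1 : (fun z : Torus d × ℝ => EuclideanSpace.single i (w z.2))
        = fun z => w z.2 • EuclideanSpace.single i (1 : ℝ) := by
      funext z
      ext j
      simp
    rw [h1]
    fun_prop
  refine MemLp.of_bound hc.aestronglyMeasurable C ?_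
  filter_upwards [ae_slab_mem] with z hz
  simpa using hC _ (Ioo_subset_Icc_self hz)

/-- The field `w(y) e_i`. -/
def verticalField (ℓ : ℝ) {w : ℝ → ℝ} (hw : Continuous w) (i : Fin (d + 1)) : VecL2 d ℓ :=
  (memLp_vertical hw i).toLp _

lemma verticalField_ae {w : ℝ → ℝ} (hw : Continuous w) (i : Fin (d + 1)) :
    ∀ᵐ z ∂(slabMeasure d ℓ), ∀ j, verticalField ℓ hw i z j = if j = i then w z.2 else 0 := by
  filter_upwards [(memLp_vertical (ℓ := ℓ) hw i).coeFn_toLp] with z hz j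
  rw [verticalField, hz]
  simp

lemma inner_verticalField (v : VecL2 d ℓ) {w : ℝ → ℝ} (hw : Continuous w) (i : Fin (d + 1)) :
    inner ℝ v (verticalField ℓ hw i) = ∫ z, v z i * w z.2 ∂(slabMeasure d ℓ) := by
  rw [L2.inner_def]
  refine integral_congr_ae ?_
  filter_upwards [verticalField_ae (ℓ := ℓ) hw i] with z hz
  rw [PiLp.inner_apply]
  simp [hz, mul_comm]

lemma integrable_component_mul_vertical (v : VecL2 d ℓ) (i : Fin (d + 1)) {ψ : ℝ → ℝ}
    (hψ : Continuous ψ) : Integrable (fun z => v z i * ψ z.2) (slabMeasure d ℓ) :=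
  integrable_mul_of_continuous v (hψ.comp continuous_snd)

lemma continuous_sin_mul (c : ℝ) : Continuous fun y : ℝ => Real.sin (c * y) := by fun_prop

lemma continuous_mul_cos_mul (c : ℝ) : Continuous fun y : ℝ => c * Real.cos (c * y) := by fun_prop

lemma hasDerivAt_sin_mul (c y : ℝ) :
    HasDerivAt (fun y : ℝ => Real.sin (c * y)) (c * Real.cos (c * y)) y :=
  (((hasDerivAt_id y).const_mul c).sin).congr_deriv (by simp [mul_comm])

lemma deriv_mul_cos_mul (c y : ℝ) :
    deriv (fun y : ℝ => c * Real.cos (c * y)) y = -c ^ 2 * Real.sin (c * y) :=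
  ((((hasDerivAt_id y).const_mul c).cos).const_mul c).deriv.trans (by simp; ring)

/-- The `k`-th sine coefficient of the horizontal average of the `i`-th component. -/
def sineCoeff (ℓ : ℝ) (k : ℕ) (i : Fin (d + 1)) (v : VecL2 d ℓ) : ℝ :=
  inner ℝ v (verticalField ℓ (continuous_sin_mul (sineFreq ℓ k)) i)

lemma sineCoeff_eq (k : ℕ) (i : Fin (d + 1)) (v : VecL2 d ℓ) :
    sineCoeff ℓ k i v = ∫ z, v z i * Real.sin (sineFreq ℓ k * z.2) ∂(slabMeasure d ℓ) :=
  inner_verticalField v _ i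

lemma continuous_sineCoeff (k : ℕ) (i : Fin (d + 1)) :
    Continuous (sineCoeff (d := d) ℓ k i) := by
  unfold sineCoeff
  fun_prop

lemma sineFreq_pos (hℓ : 0 < ℓ) (k : ℕ) : 0 < sineFreq ℓ k := by
  unfold sineFreq
  positivity

lemma sineFreq_mono (hℓ : 0 < ℓ) (k : ℕ) : sineFreq ℓ 0 ≤ sineFreq ℓ k := by
  unfold sineFreq
  gcongr
  simp

/-- The Neumann condition at the top; it makes the derivative of the sine admissible in
`HasZeroBottomTrace`. -/
lemma cos_sineFreq_mul (hℓ : 0 < ℓ) (k : ℕ) : Real.cos (sineFreq ℓ k * ℓ) = 0 := by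
  rw [Real.cos_eq_zero_iff]
  exact ⟨k, by unfold sineFreq; push_cast; field_simp⟩

lemma hasSum_sq_sineCoeff (hℓ : 0 < ℓ) (v : VecL2 d ℓ) (i : Fin (d + 1)) :
    HasSum (fun k => sineCoeff ℓ k i v ^ 2)
      (ℓ / 2 * ∫ y in (0 : ℝ)..ℓ, horizontalAvg (fun z => v z i) y ^ 2) := by
  have h := hasSum_sq_integral_sin hℓ (memLp_horizontalAvg (memLp_component v i))
  refine h.congr_fun fun k => ?_
  rw [sineCoeff_eq, integral_component_mul v i (continuous_sin_mul _),
    intervalIntegral.integral_of_le hℓ.le, integral_Ioc_eq_integral_Ioo]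

/-- The zeroth Fourier coefficient is the horizontal average. The factor `1 / ℓ` is `1 / 2` from the
energy times `2 / ℓ` from Parseval, since the sines are not normalized. -/
lemma modalEnergy_zero_eq (hℓ : 0 < ℓ) (μ : (Fin d → ℤ) → ℝ) (v : VecL2 d ℓ)
    (h : Lp ℝ 2 (volume : Measure (Torus d))) :
    modalEnergy ℓ μ 0 v h
      = 1 / ℓ * ∑ i, ∑' k, sineCoeff ℓ k i v ^ 2 + μ 0 / 2 * (∫ x, h x) ^ 2 := by
  have hc : ∀ f : Torus d → ℝ, ‖fourierCoeffTorus (fun x => (f x : ℂ)) 0‖ ^ 2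
      = (∫ x, f x) ^ 2 := by
    intro f
    simp only [fourierCoeffTorus, neg_zero, UnitAddTorus.mFourier_zero, ContinuousMap.one_apply,
      mul_one]
    rw [integral_complex_ofReal, Complex.norm_real, Real.norm_eq_abs, sq_abs]
  have hi : ∀ i ∈ Finset.univ, IntervalIntegrable
      (fun y => horizontalAvg (fun z => v z i) y ^ 2) volume 0 ℓ := fun i _ =>
    (intervalIntegrable_iff_integrableOn_Ioo_of_le hℓ.le).2
      (memLp_horizontalAvg (memLp_component v i)).integrable_sq
  simp only [modalEnergy, hc]
  congr 1
  change 1 / 2 * (∫ y in (0 : ℝ)..ℓ, ∑ i, horizontalAvg (fun z => v z i) y ^ 2) = _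
  rw [intervalIntegral.integral_finsetSum hi, Finset.mul_sum, Finset.mul_sum]
  refine Finset.sum_congr rfl fun i _ => ?_
  rw [(hasSum_sq_sineCoeff hℓ v i).tsum_eq]
  field_simp

/-! ### The sine fields as test fields -/

/-- The field `sin ((k + 1/2) π y / ℓ) e_i` with `i` horizontal, together with its gradient. -/
def sineJet (ℓ : ℝ) (k : ℕ) (i : Fin d) : JetL2 d ℓ :=
  WithLp.toLp 2 (verticalField ℓ (continuous_sin_mul (sineFreq ℓ k)) i.castSucc,
    WithLp.toLp 2 fun j =>
      if j = Fin.last d then verticalField ℓ (continuous_mul_cos_mul (sineFreq ℓ k)) i.castSucc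
      else 0)

lemma sineJet_fst (k : ℕ) (i : Fin d) : (sineJet ℓ k i).fst
    = verticalField ℓ (continuous_sin_mul (sineFreq ℓ k)) i.castSucc := rfl

lemma sineJet_snd (k : ℕ) (i : Fin d) (j : Fin (d + 1)) : (sineJet ℓ k i).snd j
    = if j = Fin.last d then
        verticalField ℓ (continuous_mul_cos_mul (sineFreq ℓ k)) i.castSucc
      else 0 := rfl

lemma sineJet_fst_ae (k : ℕ) (i : Fin d) : ∀ᵐ z ∂(slabMeasure d ℓ), ∀ a,
    (sineJet ℓ k i).fst z a = if a = i.castSucc then Real.sin (sineFreq ℓ k * z.2) else 0 := by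
  rw [sineJet_fst]
  exact verticalField_ae _ _

lemma sineJet_snd_ae (k : ℕ) (i : Fin d) : ∀ᵐ z ∂(slabMeasure d ℓ), ∀ j a,
    (sineJet ℓ k i).snd j z a = if j = Fin.last d then
      (if a = i.castSucc then sineFreq ℓ k * Real.cos (sineFreq ℓ k * z.2) else 0) else 0 := by
  filter_upwards [verticalField_ae (ℓ := ℓ) (continuous_mul_cos_mul (sineFreq ℓ k)) i.castSucc,
    Lp.coeFn_zero (EuclideanSpace ℝ (Fin (d + 1))) 2 (slabMeasure d ℓ)] with z h1 h2 j a
  by_cases hj : j = Fin.last d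
  · rw [sineJet_snd, if_pos hj, if_pos hj, h1]
  · rw [sineJet_snd, if_neg hj, if_neg hj, h2]
    rfl

lemma sineJet_mem (hℓ : 0 < ℓ) (k : ℕ) (i : Fin d) : sineJet ℓ k i ∈ divFree d ℓ := by
  have hw := hasDerivAt_sin_mul (sineFreq ℓ k)
  have hwc := continuous_sin_mul (sineFreq ℓ k)
  have hwc' := continuous_mul_cos_mul (sineFreq ℓ k)
  have hfst := sineJet_fst_ae (ℓ := ℓ) k i
  have hsnd := sineJet_snd_ae (ℓ := ℓ) k i
  refine ⟨fun a j φ hφ => ?_, fun a φ hφ h1 => ?_, ?_⟩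
  · have hpd := hφ.1.continuous_partialDeriv j
    have hc := hφ.1.continuous
    by_cases ha : a = i.castSucc
    · induction j using Fin.lastCases with
      | last =>
        have hb : ∀ z : Torus d × ℝ, z.2 ∉ Ioo 0 ℓ → φ z = 0 := fun z hz =>
          image_eq_zero_of_notMem_tsupport fun h => hz (hφ.2.2 h).2
        have h := integral_mul_partialDeriv_last (ℓ := ℓ) hφ.1 hℓ.le hw hwc'
          (fun x => by rw [hb _ (by simp), mul_zero]) (fun x => by rw [hb _ (by simp), mul_zero])
        have i1 : Integrable (fun z : Torus d × ℝ => Real.sin (sineFreq ℓ k * z.2)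
            * partialDeriv (Fin.last d) φ z) (slabMeasure d ℓ) :=
          integrable_slab_of_continuous (by fun_prop)
        have i2 : Integrable (fun z : Torus d × ℝ => sineFreq ℓ k
            * Real.cos (sineFreq ℓ k * z.2) * φ z) (slabMeasure d ℓ) :=
          integrable_slab_of_continuous (by fun_prop)
        rw [integral_add i1 i2] at h
        refine Eq.trans (integral_congr_ae ?_) ((eq_neg_of_add_eq_zero_left h).trans
          (congrArg Neg.neg (integral_congr_ae ?_)))
        · filter_upwards [hfst] with z hz
          simp [hz, ha]
        · filter_upwards [hsnd] with z hz
          simp [hz, ha]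
      | cast j =>
        refine Eq.trans (integral_congr_ae ?_)
          ((integral_mul_partialDeriv_castSucc hφ.1 j hwc).trans ?_)
        · filter_upwards [hfst] with z hz
          simp [hz, ha]
        · rw [integral_eq_zero_of_ae, neg_zero]
          filter_upwards [hsnd] with z hz
          simp [hz]
    · rw [integral_eq_zero_of_ae, integral_eq_zero_of_ae, neg_zero]
      · filter_upwards [hsnd] with z hz
        simp [hz, ha]
      · filter_upwards [hfst] with z hz
        simp [hz, ha]
  · by_cases ha : a = i.castSucc
    · refine Eq.trans ?_ (integral_mul_partialDeriv_last (ℓ := ℓ) hφ hℓ.le hw hwc'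
          (fun x => by simp) (fun x => by rw [h1, mul_zero]))
      refine integral_congr_ae ?_
      filter_upwards [hfst, hsnd] with z hz1 hz2
      simp [hz1, hz2, ha]
    · refine integral_eq_zero_of_ae ?_
      filter_upwards [hfst, hsnd] with z hz1 hz2
      simp [hz1, hz2, ha]
  · filter_upwards [hsnd] with z hz
    refine Finset.sum_eq_zero fun a _ => ?_
    rw [hz]
    -- The only nonzero derivative is the vertical one of a horizontal component, which is off the
    -- diagonal of the gradient.
    by_cases ha : a = Fin.last d
    · simp [ha, (Fin.castSucc_lt_last i).ne']
    · simp [ha]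

/-- The field `sin ((k + 1/2) π y / ℓ) e_i` as an element of the velocity space. -/
def sineField (hℓ : 0 < ℓ) (k : ℕ) (i : Fin d) : divFree d ℓ := ⟨sineJet ℓ k i, sineJet_mem hℓ k i⟩

/-- This removes the surface term, and with it `M(h)`, from the weak equation. -/
lemma hasVerticalTopTrace_sineField (hℓ : 0 < ℓ) (k : ℕ) (i : Fin d) :
    HasVerticalTopTrace (sineField hℓ k i) (0 : Lp ℝ 2 (volume : Measure (Torus d))) := by
  intro φ _ _
  have hne : Fin.last d ≠ i.castSucc := (Fin.castSucc_lt_last i).ne'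
  rw [integral_eq_zero_of_ae, integral_eq_zero_of_ae]
  · filter_upwards [Lp.coeFn_zero ℝ 2 (volume : Measure (Torus d))] with x hx
    rw [hx]
    simp
  · filter_upwards [sineJet_fst_ae (ℓ := ℓ) k i, sineJet_snd_ae (ℓ := ℓ) k i] with z hz1 hz2
    simp [sineField, hz1, hz2, hne]

lemma l2ToDual_sineField (hℓ : 0 < ℓ) (k : ℕ) (i : Fin d) (v : VecL2 d ℓ) :
    l2ToDual v (sineField hℓ k i) = sineCoeff ℓ k i.castSucc v :=
  rfl

lemma contDiff_mul_cos_mul (c : ℝ) : ContDiff ℝ ∞ fun y : ℝ => c * Real.cos (c * y) := by fun_prop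

/-- Integration by parts in `y` against the derivative of a sine function. -/
lemma integral_last_weakPartial_mul_cos (hℓ : 0 < ℓ) (k : ℕ) (i : Fin (d + 1)) {w : JetL2 d ℓ}
    (hw : w ∈ divFree d ℓ) :
    ∫ z, w.snd (Fin.last d) z i * (sineFreq ℓ k * Real.cos (sineFreq ℓ k * z.2))
        ∂(slabMeasure d ℓ) = sineFreq ℓ k ^ 2 * sineCoeff ℓ k i w.fst := by
  set c := sineFreq ℓ k with hc
  -- The zero bottom trace supplies the identity; at the top the cosine vanishes, so no boundary
  -- value of the field is needed there.
  have h := hw.2.1 i _ (isSmooth_vertical (contDiff_mul_cos_mul c))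
    (fun x => by simp only [hc]; rw [cos_sineFreq_mul hℓ, mul_zero])
  have hpd : ∀ z : Torus d × ℝ, partialDeriv (Fin.last d) (fun z => c * Real.cos (c * z.2)) z
      = -c ^ 2 * Real.sin (c * z.2) := fun z =>
    (partialDeriv_vertical_last (fun y => c * Real.cos (c * y)) z).trans (deriv_mul_cos_mul c z.2)
  simp only [hpd] at h
  rw [integral_add
    (integrable_component_mul_vertical w.fst i ((continuous_sin_mul c).const_mul (-c ^ 2)))
    (integrable_component_mul_vertical (w.snd (Fin.last d)) i (continuous_mul_cos_mul c))] at h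
  simp only [mul_left_comm _ (-c ^ 2) _] at h
  rw [integral_const_mul, ← sineCoeff_eq] at h
  linarith

/-- The symmetrized gradient of the sine field has two equal nonzero entries, paired with `∂_N v_i +
∂_i v_N`. The first summand gives the eigenvalue after integration by parts; the second has zero
horizontal average. -/
lemma symGradInner_sineField (hℓ : 0 < ℓ) (k : ℕ) (i : Fin d) (v : divFree d ℓ) :
    symGradInner v (sineField hℓ k i)
      = 2 * sineFreq ℓ k ^ 2 * sineCoeff ℓ k i.castSucc (toL2 d ℓ v) := by
  have hwc' := continuous_mul_cos_mul (sineFreq ℓ k)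
  have h1 := integral_last_weakPartial_mul_cos hℓ k i.castSucc v.2
  have h2 := integral_horizontal_weakPartial_mul (v.2.1 (Fin.last d) i.castSucc) hwc'
  have h3 : symGradInner v (sineField hℓ k i) = ∫ z,
      (2 * (v.1.snd (Fin.last d) z i.castSucc
          * (sineFreq ℓ k * Real.cos (sineFreq ℓ k * z.2)))
        + 2 * (v.1.snd i.castSucc z (Fin.last d)
          * (sineFreq ℓ k * Real.cos (sineFreq ℓ k * z.2)))) ∂(slabMeasure d ℓ) := by
    refine integral_congr_ae ?_
    filter_upwards [sineJet_snd_ae (ℓ := ℓ) k i] with z hz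
    simp only [symGrad, sineField, hz, mul_add, Finset.sum_add_distrib]
    simp only [mul_ite, mul_zero, Finset.sum_ite_eq', Finset.mem_univ, if_true,
      Finset.sum_ite_irrel, Finset.sum_const_zero]
    ring
  rw [h3, integral_add
    ((integrable_component_mul_vertical (v.1.snd (Fin.last d)) i.castSucc hwc').const_mul 2)
    ((integrable_component_mul_vertical (v.1.snd i.castSucc) (Fin.last d) hwc').const_mul 2), integral_const_mul, integral_const_mul, h1, h2]
  change 2 * (sineFreq ℓ k ^ 2 * sineCoeff ℓ k i.castSucc v.1.fst) + 2 * 0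
    = 2 * sineFreq ℓ k ^ 2 * sineCoeff ℓ k i.castSucc v.1.fst
  ring

/-- The horizontal average of the vertical velocity vanishes. -/
lemma sineCoeff_last_eq_zero (hℓ : 0 < ℓ) (k : ℕ) (v : divFree d ℓ) :
    sineCoeff ℓ k (Fin.last d) (toL2 d ℓ v) = 0 := by
  have hwc' := continuous_mul_cos_mul (sineFreq ℓ k)
  have h1 := integral_last_weakPartial_mul_cos hℓ k (Fin.last d) v.2
  -- Incompressibility trades `∂_N v_N` for horizontal derivatives, whose averages vanish; `h1` then
  -- says that `λ_k²` times the coefficient is zero.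
  have h2 : ∫ z, v.1.snd (Fin.last d) z (Fin.last d)
      * (sineFreq ℓ k * Real.cos (sineFreq ℓ k * z.2)) ∂(slabMeasure d ℓ)
      = ∫ z, ∑ j : Fin d, -(v.1.snd j.castSucc z j.castSucc
        * (sineFreq ℓ k * Real.cos (sineFreq ℓ k * z.2))) ∂(slabMeasure d ℓ) := by
    refine integral_congr_ae ?_
    filter_upwards [v.2.2.2] with z hz
    rw [Fin.sum_univ_castSucc] at hz
    rw [Finset.sum_neg_distrib, ← Finset.sum_mul, ← neg_mul]
    congr 1
    linarith
  rw [h2, integral_finsetSum _ fun j _ => (integrable_component_mul_vertical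
    (v.1.snd j.castSucc) j.castSucc hwc').neg] at h1
  rw [Finset.sum_eq_zero fun j _ => by
    rw [integral_neg, integral_horizontal_weakPartial_mul (v.2.1 j.castSucc j.castSucc) hwc',
      neg_zero]] at h1
  have hpos := sineFreq_pos hℓ k
  exact (mul_eq_zero.1 h1.symm).resolve_left (by positivity)

/-! ### Evolution of the sine coefficients -/

lemma L2Loc.locallyIntegrableOn {X : Type*} [NormedAddCommGroup X] {f : ℝ → X} (hf : L2Loc f) :
    LocallyIntegrableOn f (Ioi 0) := by
  rw [locallyIntegrableOn_iff isOpen_Ioi.isLocallyClosed]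
  intro K hK hKc
  obtain ⟨q, hq⟩ := hKc.bddAbove
  have hT : (0 : ℝ) < max q 1 := lt_max_of_lt_right one_pos
  have h1 : IntegrableOn f (Icc 0 (max q 1)) := (hf _ hT).integrable (by norm_num)
  exact h1.mono_set fun t ht => ⟨(hK ht).le, (hq ht).trans (le_max_left _ _)⟩

lemma ae_Ioi_of_forall_ae_Icc {p : ℝ → Prop}
    (h : ∀ T : ℝ, 0 < T → ∀ᵐ t ∂(volume.restrict (Icc 0 T)), p t) :
    ∀ᵐ t ∂(volume.restrict (Ioi (0 : ℝ))), p t := by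
  have h1 : ∀ᵐ t ∂(volume.restrict (⋃ n : ℕ, Icc (0 : ℝ) (n + 1))), p t := by
    rw [ae_restrict_iUnion_iff]
    exact fun n => h _ (by positivity)
  refine ae_restrict_of_ae_restrict_of_subset (fun t ht => ?_) h1
  obtain ⟨n, hn⟩ := exists_nat_ge t
  exact mem_iUnion.2 ⟨n, le_of_lt ht, by linarith⟩

lemma continuous_l2ToDual : Continuous (l2ToDual (d := d) (ℓ := ℓ)) :=
  (innerSL ℝ).continuous.clm_comp continuous_const

lemma norm_l2ToDual_le (v : VecL2 d ℓ) : ‖l2ToDual v‖ ≤ ‖toL2 d ℓ‖ * ‖v‖ := by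
  refine (ContinuousLinearMap.opNorm_comp_le _ _).trans ?_
  rw [innerSL_apply_norm, mul_comm]

lemma L2Loc.l2ToDual_toL2 {u : ℝ → divFree d ℓ} (hu : L2Loc u) :
    L2Loc fun t => l2ToDual (toL2 d ℓ (u t)) := by
  intro T hT
  have h1 := (toL2 d ℓ).comp_memLp' (hu T hT)
  refine h1.of_le_mul (c := ‖toL2 d ℓ‖)
    (continuous_l2ToDual.comp_aestronglyMeasurable h1.1) ?_
  exact Eventually.of_forall fun t => norm_l2ToDual_le _

variable {μ : (Fin d → ℤ) → ℝ} {u : ℝ → divFree d ℓ}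
  {h : ℝ → Lp ℝ 2 (volume : Measure (Torus d))} {u₀ : VecL2 d ℓ}
  {h₀ : Lp ℝ 2 (volume : Measure (Torus d))}

lemma sineCoeff_eq_of_ae_eq_exp {k : ℕ} {i : Fin (d + 1)} {lam c : ℝ}
    (hu₀ : HasInitialValue (fun t => toL2 d ℓ (u t)) u₀)
    (h : ∀ᵐ t ∂(volume.restrict (Ioi (0 : ℝ))),
      sineCoeff ℓ k i (toL2 d ℓ (u t)) = c * Real.exp (-lam * t)) :
    sineCoeff ℓ k i u₀ = c := by
  have hcomp : HasInitialValue (fun t => sineCoeff ℓ k i (toL2 d ℓ (u t)))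
      (sineCoeff ℓ k i u₀) := by
    intro ε hε
    obtain ⟨η, hη, hball⟩ := Metric.continuousAt_iff.1
      (continuous_sineCoeff (ℓ := ℓ) k i).continuousAt ε hε
    obtain ⟨τ, hτ, hae⟩ := hu₀ η hη
    refine ⟨τ, hτ, hae.mono fun t ht => ?_⟩
    rw [← dist_eq_norm]
    exact hball (by rwa [dist_eq_norm])
  refine eq_of_ae_eq_of_tendsto hcomp h ?_
  have hc : Continuous fun t : ℝ => c * Real.exp (-lam * t) := by fun_prop
  have := (hc.tendsto 0).mono_left (nhdsWithin_le_nhds (s := Ioi 0))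
  simpa using this

/-- The sine coefficients of a weak solution decay exponentially. -/
lemma IsWeakSolution.sineCoeff_ae_eq (hℓ : 0 < ℓ) (hs : IsWeakSolution ℓ μ u h u₀ h₀) (k : ℕ)
    (i : Fin (d + 1)) :
    ∀ᵐ t ∂(volume.restrict (Ioi (0 : ℝ))), sineCoeff ℓ k i (toL2 d ℓ (u t))
      = sineCoeff ℓ k i u₀ * Real.exp (-sineFreq ℓ k ^ 2 * t) := by
  obtain ⟨ut, ht, Mh, hu, hut, hweak, -, -, -, -, -, -, heq, -, hu₀, -, -⟩ := hs
  have hexp : ∃ c : ℝ, ∀ᵐ t ∂(volume.restrict (Ioi (0 : ℝ))),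
      sineCoeff ℓ k i (toL2 d ℓ (u t)) = c * Real.exp (-sineFreq ℓ k ^ 2 * t) := by
    induction i using Fin.lastCases with
    | last => exact ⟨0, Eventually.of_forall fun t => by rw [sineCoeff_last_eq_zero hℓ, zero_mul]⟩
    | cast i =>
      set v := sineField hℓ k i with hv
      have hode : ∀ᵐ t ∂(volume.restrict (Ioi (0 : ℝ))),
          ut t v = -(sineFreq ℓ k ^ 2 * sineCoeff ℓ k i.castSucc (toL2 d ℓ (u t))) := by
        refine ae_Ioi_of_forall_ae_Icc fun T hT => ?_
        -- The test field is constant in time and its vertical trace is `g = 0`.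
        filter_upwards [heq T hT (fun _ => v) (memLp_const v)] with t ht
        have h1 := ht 0 (hasVerticalTopTrace_sineField hℓ k i)
        have h2 : ∫ x, Mh t x * (((0 : Lp ℝ 2 (volume : Measure (Torus d))) x : ℝ) : ℂ) = 0 := by
          refine integral_eq_zero_of_ae ?_
          filter_upwards [Lp.coeFn_zero ℝ 2 (volume : Measure (Torus d))] with x hx
          rw [hx]
          simp
        rw [h2, add_zero, Complex.ofReal_eq_zero, symGradInner_sineField hℓ] at h1
        linarith
      have hU := hu.l2ToDual_toL2.locallyIntegrableOn
      have ha : LocallyIntegrableOn (fun t => sineCoeff ℓ k i.castSucc (toL2 d ℓ (u t)))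
          (Ioi 0) := by
        have hL2 : L2Loc fun t => sineCoeff ℓ k i.castSucc (toL2 d ℓ (u t)) := fun T hT =>
          ((toL2 d ℓ).comp_memLp' (hu T hT)).inner_const _
        exact hL2.locallyIntegrableOn
      refine ae_eq_exp_of_weak_ode ha fun φ hφ hφc hφs => ?_
      -- Evaluating the dual-valued weak derivative at the fixed field `v` gives a scalar weak
      -- equation.
      have hw := congrArg (fun L : DivFreeDual d ℓ => L v) (hweak φ hφ hφc hφs)
      simp only [neg_apply] at hw
      rw [ContinuousLinearMap.integral_apply
          (integrableOn_Ioi_smul hU (hφ.continuous_deriv (by simp)) hφc.deriv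
            (tsupport_deriv_subset.trans hφs)),
        ContinuousLinearMap.integral_apply
          (integrableOn_Ioi_smul hut.locallyIntegrableOn hφ.continuous hφc hφs)] at hw
      simp only [smul_apply, smul_eq_mul, hv, l2ToDual_sineField] at hw
      rw [hw, ← integral_neg, ← integral_const_mul]
      refine integral_congr_ae ?_
      filter_upwards [hode] with t ht
      rw [← hv, ht]
      ring
  obtain ⟨c, hc⟩ := hexp
  rwa [sineCoeff_eq_of_ae_eq_exp hu₀ hc]

/-- The zero average is assumed only for almost every positive time; it passes to the initial datum
because integration is continuous on `L²`. -/
lemma IsWeakSolution.integral_initial_eq_zero (hs : IsWeakSolution ℓ μ u h u₀ h₀) :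
    ∫ x, h₀ x = 0 := by
  obtain ⟨ut, ht, Mh, -, -, -, -, -, -, -, -, -, -, -, -, hh₀, hmean⟩ := hs
  have hint : ∀ f : Lp ℝ 2 (volume : Measure (Torus d)), Integrable f := fun f =>
    (Lp.memLp f).integrable (by norm_num)
  have hle : ∀ f : Lp ℝ 2 (volume : Measure (Torus d)), ‖∫ x, f x‖ ≤ ‖f‖ := fun f => by
    refine (norm_integral_le_integral_norm _).trans ?_
    rw [integral_norm_eq_lintegral_enorm (hint f).1, ← eLpNorm_one_eq_lintegral_enorm, Lp.norm_def]
    refine ENNReal.toReal_mono (Lp.eLpNorm_ne_top f) ?_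
    exact eLpNorm_le_eLpNorm_of_exponent_le (by norm_num) (hint f).1
  refine eq_of_ae_eq_of_tendsto (f := fun t => ∫ x, h t x) (fun ε hε => ?_) hmean
    tendsto_const_nhds
  obtain ⟨τ, hτ, hae⟩ := hh₀ ε hε
  refine ⟨τ, hτ, hae.mono fun t ht => ?_⟩
  rw [← integral_sub (hint _) (hint _)]
  refine lt_of_le_of_lt (le_of_eq_of_le ?_ (hle (h t - h₀))) ht
  congr 1
  refine integral_congr_ae ?_
  filter_upwards [Lp.coeFn_sub (h t) h₀] with x hx
  rw [hx, Pi.sub_apply]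

end SlabFlow

end

/-! ### Decay of the zero-mode energy -/

theorem theorem3p3 (d : ℕ) (hd : 1 ≤ d) (ℓ : ℝ) (hℓ : 0 < ℓ) :
    ∃ δ : ℝ, 0 < δ ∧
      ∀ (μ : (Fin d → ℤ) → ℝ), SlabFlow.IsAdmissibleSymbol μ →
      ∀ (u : ℝ → SlabFlow.divFree d ℓ) (h : ℝ → Lp ℝ 2 (volume : Measure (SlabFlow.Torus d)))
        (u₀ : SlabFlow.VecL2 d ℓ) (h₀ : Lp ℝ 2 (volume : Measure (SlabFlow.Torus d))),
        SlabFlow.IsWeakSolution ℓ μ u h u₀ h₀ →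
        ∃ E : ℝ → ℝ, ContinuousOn E (Ici 0) ∧
          (∀ᵐ t ∂(volume.restrict (Ioi (0 : ℝ))),
            E t = SlabFlow.modalEnergy ℓ μ 0 (SlabFlow.toL2 d ℓ (u t)) (h t)) ∧
          E 0 = SlabFlow.modalEnergy ℓ μ 0 u₀ h₀ ∧
          ∀ t : ℝ, 0 ≤ t → E t ≤ E 0 * Real.exp (-δ * t) := by
  have hpos := SlabFlow.sineFreq_pos hℓ 0
  -- `δ = 2 λ_0² = π² / (2 ℓ²)`: the lowest frequency decays slowest, and the energy is quadratic in
  -- the coefficients.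
  refine ⟨2 * SlabFlow.sineFreq ℓ 0 ^ 2, by positivity, fun μ _ u h u₀ h₀ hs => ?_⟩
  have hsum : ∀ i, Summable fun k => SlabFlow.sineCoeff ℓ k i u₀ ^ 2 := fun i =>
    (SlabFlow.hasSum_sq_sineCoeff hℓ u₀ i).summable
  have hle1 : ∀ (i : Fin (d + 1)) (k : ℕ) (t : ℝ), 0 ≤ t →
      (SlabFlow.sineCoeff ℓ k i u₀ * Real.exp (-SlabFlow.sineFreq ℓ k ^ 2 * t)) ^ 2
        ≤ SlabFlow.sineCoeff ℓ k i u₀ ^ 2 * Real.exp (-(2 * SlabFlow.sineFreq ℓ 0 ^ 2) * t) := by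
    intro i k t ht
    rw [mul_pow, ← Real.exp_nat_mul]
    refine mul_le_mul_of_nonneg_left (Real.exp_le_exp.2 ?_) (sq_nonneg _)
    have h1 : SlabFlow.sineFreq ℓ 0 ^ 2 ≤ SlabFlow.sineFreq ℓ k ^ 2 :=
      pow_le_pow_left₀ hpos.le (SlabFlow.sineFreq_mono hℓ k) 2
    push_cast
    linarith [mul_le_mul_of_nonneg_right h1 ht]
  -- A summable majorant independent of `t`, which makes the series converge uniformly down to `t =
  -- 0`.
  have hle2 : ∀ (i : Fin (d + 1)) (k : ℕ) (t : ℝ), 0 ≤ t →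
      (SlabFlow.sineCoeff ℓ k i u₀ * Real.exp (-SlabFlow.sineFreq ℓ k ^ 2 * t)) ^ 2
        ≤ SlabFlow.sineCoeff ℓ k i u₀ ^ 2 := fun i k t ht =>
    (hle1 i k t ht).trans (mul_le_of_le_one_right (sq_nonneg _)
      (Real.exp_le_one_iff.2 (by nlinarith [sq_nonneg (SlabFlow.sineFreq ℓ 0)])))
  -- The representative is built from `u₀` alone, which makes it defined for every `t` and not just
  -- almost every one.
  refine ⟨fun t => 1 / ℓ * ∑ i, ∑' k,
    (SlabFlow.sineCoeff ℓ k i u₀ * Real.exp (-SlabFlow.sineFreq ℓ k ^ 2 * t)) ^ 2,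
    ?_, ?_, ?_, fun t ht => ?_⟩
  · refine continuousOn_const.mul (continuousOn_finsetSum _ fun i _ => ?_)
    refine continuousOn_tsum (fun k => by fun_prop) (hsum i) fun k t ht => ?_
    rw [Real.norm_of_nonneg (sq_nonneg _)]
    exact hle2 i k t ht
  · have hcoeff : ∀ᵐ t ∂(volume.restrict (Ioi (0 : ℝ))), ∀ i k,
        SlabFlow.sineCoeff ℓ k i (SlabFlow.toL2 d ℓ (u t))
          = SlabFlow.sineCoeff ℓ k i u₀ * Real.exp (-SlabFlow.sineFreq ℓ k ^ 2 * t) :=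
      ae_all_iff.2 fun i => ae_all_iff.2 fun k => hs.sineCoeff_ae_eq hℓ k i
    obtain ⟨_, _, _, -, -, -, -, -, -, -, -, -, -, -, -, -, hmean⟩ := hs
    filter_upwards [hcoeff, hmean] with t ht1 ht2
    rw [SlabFlow.modalEnergy_zero_eq hℓ, ht2]
    simp [ht1]
  · rw [SlabFlow.modalEnergy_zero_eq hℓ, hs.integral_initial_eq_zero]
    simp
  · simp only [mul_zero, Real.exp_zero, mul_one]
    rw [mul_assoc, Finset.sum_mul]
    refine mul_le_mul_of_nonneg_left (Finset.sum_le_sum fun i _ => ?_) (by positivity)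
    rw [← tsum_mul_right]
    exact Summable.tsum_le_tsum (fun k => hle1 i k t ht)
      (Summable.of_nonneg_of_le (fun k => sq_nonneg _) (fun k => hle2 i k t ht) (hsum i))
      ((hsum i).mul_right _)
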